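/- For a function $V:\mathbb R\to\mathbb R$ and a Borel probability measure $\mu$ on $\mathbb R$ let \[ E(\mu)=\int V(x)\,\mu(dx)-\iint \log|x-y|\,\mu(dx)\,\mu(dy) \] if both integrals exist and are finite, and $E(\mu)=+\infty$ otherwise (in particular if $\mu$ has an atom). Let $\mu_V$ denote the equilibrium measure of $V$, that is, the minimizer of $E$ among all Borel probability measures on $\mathbb R$. For $p\ge 1$ let \[ W_p(\mu,\nu)=\inf_{\pi}\Big(\iint |x-y|^p\,\pi(dx,dy)\Big)^{1/p}\in[0,\infty], \] where $\pi$ runs over the probability measures on $\mathbb R^2$ with marginals $\mu$ and $\nu$. Theorem. Let $V:\mathbb R\to\mathbb R$ be of class $C^2$. (1) If $V(x)-\rho x^2$ is convex for some $\rho>0$, then for every Borel probability measure $\mu$ on $\mathbb R$, \[ \rho\, W_2^2(\mu,\mu_V)\le E(\mu)-E(\mu_V). \] If $V(x)=\rho x^2$ with $\rho>0$, then equality holds for every $\mu=\theta_{\#}\mu_V$ with $\theta(x)=x+m$, $m\in\mathbb R$; therefore the constant $\rho$ in front of $W_2^2(\mu,\mu_V)$ is sharp, i.e. it cannot be replaced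 by a larger one. (2) If $V$ is convex and $V''(x)\ge\rho>0$ for all $|x|\ge r$, then there is a constant $C=C(r,\rho,\mu_V,V)>0$ such that for every Borel probability measure $\mu$ on $\mathbb R$, \[ C\, W_2^2(\mu,\mu_V)\le E(\mu)-E(\mu_V). \] (3) If $V(x)-\rho|x|^p$ is convex for some real numbers $p>1$ and $\rho>0$ (since $V$ is $C^2$, this can only happen if $p\ge 2$), then for every Borel probability measure $\mu$ on $\mathbb R$, \[ c_p\,\rho\, W_p^p(\mu,\mu_V)\le E(\mu)-E(\mu_V), \] where $c_p=\inf_{x\in\mathbb R}\big(|1+x|^p-|x|^p-p\,\mathrm{sign}(x)|x|^{p-1}\big)$, and $c_p>0$ under these hypotheses. -/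

import Mathlib

open MeasureTheory
open scoped ENNReal

/-- `μ` has finite logarithmic energy with external field `V`: both `∫ V dμ` and
`∬ log |x - y| μ(dx) μ(dy)` exist and are finite. Since `log 0 = -∞` in this context (whereas
`Real.log 0 = 0`), an atom makes the double integral `-∞`, so that atoms are excluded. -/
def HasFiniteLogEnergy (V : ℝ → ℝ) (μ : Measure ℝ) : Prop :=
  Integrable V μ ∧ (∀ x : ℝ, μ {x} = 0) ∧
    Integrable (fun z : ℝ × ℝ => Real.log |z.1 - z.2|) (μ.prod μ)

open Classical in
/-- The logarithmic energy with external field `V`,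
`E_V(μ) = ∫ V(x) μ(dx) - ∬ log |x - y| μ(dx) μ(dy)`, equal to `+∞` where this is not finite. -/
noncomputable def logEnergy (V : ℝ → ℝ) (μ : Measure ℝ) : EReal :=
  if HasFiniteLogEnergy V μ then
    (((∫ x, V x ∂μ) - ∫ z : ℝ × ℝ, Real.log |z.1 - z.2| ∂(μ.prod μ) : ℝ) : EReal)
  else ⊤

/-- `μV` is the equilibrium measure of `V`: it minimizes the logarithmic energy with external
field `V` among all Borel probability measures on the line. -/
def IsEquilibriumMeasure (V : ℝ → ℝ) (μV : Measure ℝ) : Prop :=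
  IsProbabilityMeasure μV ∧
    ∀ ν : Measure ℝ, IsProbabilityMeasure ν → logEnergy V μV ≤ logEnergy V ν

/-- The set of probability measures on the plane with marginals `μ` and `ν`. -/
def couplings (μ ν : Measure ℝ) : Set (Measure (ℝ × ℝ)) :=
  {π | IsProbabilityMeasure π ∧ π.map Prod.fst = μ ∧ π.map Prod.snd = ν}

/-- The Wasserstein distance `W_p(μ, ν) = inf_π (∬ |x - y|^p π(dx, dy))^(1/p)`, possibly `∞`. -/
noncomputable def wassersteinDist (p : ℝ) (μ ν : Measure ℝ) : ℝ≥0∞ :=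
  ⨅ π ∈ couplings μ ν, (∫⁻ z : ℝ × ℝ, ENNReal.ofReal (|z.1 - z.2| ^ p) ∂π) ^ (1 / p)

/-- The constant `c_p = inf_x (|1 + x|^p - |x|^p - p sign(x) |x|^(p-1))`. For `p ≥ 1` the
infimum is over a set of reals that is bounded below, by `0`. -/
noncomputable def transportConst (p : ℝ) : ℝ :=
  ⨅ x : ℝ, (|1 + x| ^ p - |x| ^ p - p * Real.sign x * |x| ^ (p - 1))

/-! The proof rests on displacement convexity of the energy. Let ν be the equilibrium measure and μ
a competitor of finite energy. Since ν has no atoms, there is a map θ, monotone on a set of full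
ν-measure, that carries ν to μ. Move ν along T_t = id + t(θ - id). With q = (θ(x) - θ(y)) / (x - y)
> 0, the logarithm of the distance between two points changes by log(1 + t(q - 1)), so both parts of
the energy are convex in t.

By minimality the difference quotient of the energy at 0 is nonnegative, so subtracting it from E(μ)
- E(ν) can only lower the gap. What remains is an integral of nonnegative terms. Fatou's lemma as t
→ 0 gives ∫ (V(θ) - V - V'(θ - id)) dν + ∬ (q - 1 - log q) dν dν ≤ E(μ) - E(ν), which is
`exists_transport_lintegral_le`. No Euler-Lagrange equation is needed. The graph of θ is a coupling,
so a lower bound for the left side by ∫ |θ - id|^p dν is a transport inequality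
(`mul_wassersteinDist_rpow_le_sub`).

For (1) and (3) the Bregman term alone dominates |θ(x) - x|^p, and the logarithmic term is dropped.
In the quadratic case a translation changes the energy by exactly ρm², because ν is centred, while
every coupling of ν with its translate costs at least m².

For (2) the Bregman term may vanish where V is flat, and the logarithmic term compensates: it is
small only if θ displaces x and y by similar amounts. It is therefore enough that ν charges a ball S
on which V'' is bounded below. Long displacements and far points are controlled by the convexity at
infinity, displacements of points of S by V'' there, and all others by comparison with a point of S
(`sq_le_of_far_of_near`). That S exists is `measure_deriv_two_pos`: otherwise ν has bounded support
with V'' ≤ 0 on it; the support has no gap (`mem_support_of_convexOn`), so V' is constant on it, and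
the first variation of the energy under dilation gives 1 ≤ 0. -/

/-! ### Convexity and Bregman divergences on the line -/

/-- The Bregman divergence of a function on the line. -/
noncomputable def bregman (V : ℝ → ℝ) (x y : ℝ) : ℝ := V y - V x - deriv V x * (y - x)

theorem ConvexOn.add_deriv_mul_le {s : Set ℝ} {f : ℝ → ℝ} {f' x y : ℝ} (hf : ConvexOn ℝ s f)
    (hx : x ∈ s) (hy : y ∈ s) (hd : HasDerivAt f f' x) : f x + f' * (y - x) ≤ f y := by
  rcases lt_trichotomy x y with h | rfl | h
  · have := hf.le_slope_of_hasDerivAt hx hy h hd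
    rw [slope_def_field, le_div_iff₀ (by linarith)] at this
    linarith
  · simp
  · have := hf.slope_le_of_hasDerivAt hy hx h hd
    rw [slope_def_field, div_le_iff₀ (by linarith)] at this
    linarith

theorem bregman_nonneg {V : ℝ → ℝ} (hV : Differentiable ℝ V) (hc : ConvexOn ℝ Set.univ V)
    (x y : ℝ) : 0 ≤ bregman V x y := by
  have := hc.add_deriv_mul_le (Set.mem_univ x) (Set.mem_univ y) (hV x).hasDerivAt
  unfold bregman; linarith

theorem ConvexOn.monotone_deriv_of_differentiable {V : ℝ → ℝ} (hc : ConvexOn ℝ Set.univ V)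
    (hV : Differentiable ℝ V) : Monotone (deriv V) := by
  intro x y hxy
  rcases hxy.eq_or_lt with rfl | h
  · exact le_rfl
  have h1 := bregman_nonneg hV hc x y
  have h2 := bregman_nonneg hV hc y x
  unfold bregman at h1 h2
  nlinarith

/-- Bregman divergences of convex functions increase when the segment is enlarged. -/
theorem bregman_le_bregman {V : ℝ → ℝ} (hV : Differentiable ℝ V) (hc : ConvexOn ℝ Set.univ V)
    {x y x' y' : ℝ} (h : (x ≤ x' ∧ x' ≤ y' ∧ y' ≤ y) ∨ (y ≤ y' ∧ y' ≤ x' ∧ x' ≤ x)) :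
    bregman V x' y' ≤ bregman V x y := by
  have hm := hc.monotone_deriv_of_differentiable hV
  have h1 := bregman_nonneg hV hc x x'
  have h2 := bregman_nonneg hV hc y' y
  unfold bregman at *
  rcases h with ⟨a, b, c⟩ | ⟨a, b, c⟩
  -- The divergence from x to y exceeds the one from x' to y' by the divergences from x to x' and
  -- from y' to y, plus (V'(x') - V'(x))(y' - x') and (V'(y') - V'(x))(y - y'). All four are
  -- nonnegative when V' is monotone.
  · have e1 := hm a
    have e2 := hm b
    nlinarith [mul_nonneg (sub_nonneg.2 e1) (sub_nonneg.2 b),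
      mul_nonneg (sub_nonneg.2 e1) (sub_nonneg.2 c), mul_nonneg (sub_nonneg.2 e2) (sub_nonneg.2 c)]
  · have e1 := hm b
    have e2 := hm c
    nlinarith [mul_nonneg (sub_nonneg.2 e2) (sub_nonneg.2 b),
      mul_nonneg (sub_nonneg.2 e2) (sub_nonneg.2 a), mul_nonneg (sub_nonneg.2 e1) (sub_nonneg.2 a)]

theorem ContDiff.hasDerivAt_deriv_two {V : ℝ → ℝ} (hV : ContDiff ℝ 2 V) :
    Differentiable ℝ (deriv V) ∧ Continuous (deriv (deriv V)) := by
  have h : ContDiff ℝ 1 (deriv V) := by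
    have h2 : ContDiff ℝ (1 + 1) V := by simpa [one_add_one_eq_two] using hV
    exact (contDiff_succ_iff_deriv.1 h2).2.2
  exact ⟨h.differentiable one_ne_zero, h.continuous_deriv le_rfl⟩

/-- Subtracting c z² / 2 leaves a function that is convex on the segment, hence above its tangent at
x. The curvature bound is asked only on the segment, which is what the localized estimates of part
(2) need. -/
theorem le_bregman_of_le_deriv_two {V : ℝ → ℝ} (hV : ContDiff ℝ 2 V) {c x y : ℝ}
    (h : ∀ z ∈ Set.uIcc x y, c ≤ deriv (deriv V) z) : c / 2 * (y - x) ^ 2 ≤ bregman V x y := by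
  have hd : Differentiable ℝ V := hV.differentiable two_ne_zero
  have hd2 := hV.hasDerivAt_deriv_two.1
  have hder : ∀ z, HasDerivAt (fun z => V z - c / 2 * z ^ 2) (deriv V z - c * z) z := by
    intro z
    have := (hd z).hasDerivAt.fun_sub ((hasDerivAt_pow 2 z).const_mul (c / 2))
    exact this.congr_deriv (by push_cast; ring)
  have hder' : deriv (fun z => V z - c / 2 * z ^ 2) = fun z => deriv V z - c * z :=
    funext fun z => (hder z).deriv
  have hder2 : ∀ z, HasDerivAt (fun z => deriv V z - c * z) (deriv (deriv V) z - c) z := by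
    intro z
    simpa using (hd2 z).hasDerivAt.fun_sub ((hasDerivAt_id z).const_mul c)
  have hcv : ConvexOn ℝ (Set.uIcc x y) (fun z => V z - c / 2 * z ^ 2) := by
    apply convexOn_of_deriv2_nonneg' (convex_uIcc x y)
    · exact fun z _ => (hder z).differentiableAt.differentiableWithinAt
    · rw [hder']; exact fun z _ => (hder2 z).differentiableAt.differentiableWithinAt
    · intro z hz
      simp only [Function.iterate_succ, Function.iterate_zero, Function.comp, id]
      rw [hder', (hder2 z).deriv]
      linarith [h z hz]
  have := hcv.add_deriv_mul_le Set.left_mem_uIcc Set.right_mem_uIcc (hder x)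
  unfold bregman
  nlinarith

theorem bregman_le_of_deriv_two_le {V : ℝ → ℝ} (hV : ContDiff ℝ 2 V) {c x y : ℝ}
    (h : ∀ z ∈ Set.uIcc x y, deriv (deriv V) z ≤ c) : bregman V x y ≤ c / 2 * (y - x) ^ 2 := by
  have hd : deriv (fun x => - V x) = fun x => - deriv V x := funext fun x => by simp
  have := le_bregman_of_le_deriv_two (V := fun x => - V x) hV.neg (c := -c) (x := x) (y := y) (by
    intro z hz
    rw [hd, deriv.fun_neg]
    exact neg_le_neg (h z hz))
  unfold bregman at *
  rw [hd] at this
  linarith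

theorem bddBelow_of_quadratic {V : ℝ → ℝ} {a b c : ℝ} (hc : 0 < c)
    (h : ∀ y, a + b * y + c * y ^ 2 ≤ V y) : ∃ m, ∀ y, m ≤ V y := by
  refine ⟨a - b ^ 2 / (4 * c), fun y => le_trans ?_ (h y)⟩
  have : 0 ≤ c * (y + b / (2 * c)) ^ 2 := by positivity
  have e : c * (y + b / (2 * c)) ^ 2 = c * y ^ 2 + b * y + b ^ 2 / (4 * c) := by
    field_simp; ring
  linarith

/-- With s = √q, the bound log s ≤ s - 1 gives q - 1 - log q ≥ (s - 1)². Then |q - 1| = |s - 1|(s +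
1) yields |s - 1| ≥ v / 3 when s ≤ 2, and for s ≥ 2 it is enough that v ≤ 1. -/
theorem sq_div_nine_le_sub_one_sub_log {q v : ℝ} (hq : 0 < q) (hv : 0 ≤ v) (hv1 : v ≤ 1)
    (h : v ≤ |q - 1|) : v ^ 2 / 9 ≤ q - 1 - Real.log q := by
  set s := Real.sqrt q
  have hs : 0 < s := Real.sqrt_pos.2 hq
  have hsq : s ^ 2 = q := Real.sq_sqrt hq.le
  have hlog : Real.log q ≤ 2 * (s - 1) := by
    rw [← hsq, Real.log_pow]
    have := Real.log_le_sub_one_of_pos hs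
    push_cast; linarith
  have key : v / 3 ≤ |s - 1| := by
    have e : |q - 1| = |s - 1| * (s + 1) := by
      rw [← hsq, show s ^ 2 - 1 = (s - 1) * (s + 1) by ring, abs_mul, abs_of_pos (by linarith : 0 < s + 1)]
    rcases le_total s 2 with h2 | h2
    · rw [e] at h
      nlinarith [abs_nonneg (s - 1)]
    · rw [abs_of_nonneg (by linarith)]; linarith
  have : (v / 3) ^ 2 ≤ |s - 1| ^ 2 := pow_le_pow_left₀ (by positivity) key 2
  rw [sq_abs] at this
  nlinarith

/-! ### Powers of the absolute value -/

theorem convexOn_abs_rpow {p : ℝ} (hp : 1 ≤ p) : ConvexOn ℝ Set.univ (fun x : ℝ => |x| ^ p) := by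
  refine ⟨convex_univ, fun x _ y _ a b ha hb hab => ?_⟩
  simp only [smul_eq_mul]
  have h1 : |a * x + b * y| ≤ a * |x| + b * |y| := by
    refine (abs_add_le _ _).trans ?_
    rw [abs_mul, abs_mul, abs_of_nonneg ha, abs_of_nonneg hb]
  refine (Real.rpow_le_rpow (abs_nonneg _) h1 (by linarith)).trans ?_
  exact (convexOn_rpow hp).2 (abs_nonneg x) (abs_nonneg y) ha hb hab

theorem hasDerivAt_abs_rpow_sign (x : ℝ) {p : ℝ} (hp : 1 < p) :
    HasDerivAt (fun x : ℝ => |x| ^ p) (p * Real.sign x * |x| ^ (p - 1)) x := by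
  convert hasDerivAt_abs_rpow x hp using 1
  rcases eq_or_ne x 0 with rfl | hx
  · simp
  · have : |x| ^ (p - 1) = |x| ^ (p - 2) * |x| := by
      rw [show p - 1 = p - 2 + 1 by ring, Real.rpow_add_one (abs_ne_zero.2 hx)]
    rw [this]
    rcases lt_or_gt_of_ne hx with h | h
    · rw [Real.sign_of_neg h, abs_of_neg h]; ring
    · rw [Real.sign_of_pos h, abs_of_pos h]; ring

/-- Clarkson's inequality on the line. -/
theorem abs_half_add_rpow_add_abs_half_sub_rpow_le {p : ℝ} (hp : 2 ≤ p) (a b : ℝ) :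
    |(a + b) / 2| ^ p + |(a - b) / 2| ^ p ≤ (|a| ^ p + |b| ^ p) / 2 := by
  have hp1 : 1 ≤ p / 2 := by linarith
  have e : ∀ u : ℝ, |u| ^ p = (u ^ 2) ^ (p / 2) := by
    intro u
    rw [← sq_abs, ← Real.rpow_natCast, ← Real.rpow_mul (abs_nonneg u)]
    congr 1; push_cast; ring
  simp only [e]
  have h1 := Real.add_rpow_le_rpow_add (sq_nonneg ((a + b) / 2)) (sq_nonneg ((a - b) / 2)) hp1
  have h2 := (convexOn_rpow hp1).2 (sq_nonneg a) (sq_nonneg b) (by norm_num : (0 : ℝ) ≤ 1 / 2)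
    (by norm_num : (0 : ℝ) ≤ 1 / 2) (by norm_num)
  simp only [smul_eq_mul] at h2
  have e2 : ((a + b) / 2) ^ 2 + ((a - b) / 2) ^ 2 = 1 / 2 * a ^ 2 + 1 / 2 * b ^ 2 := by ring
  rw [e2] at h1
  linarith

/-- Clarkson's inequality for 1 + x and x bounds |1 + x|^p + |x|^p below by twice the value at the
midpoint x + 1/2, plus 2^(1 - p). The tangent at x bounds the midpoint value from below. -/
theorem two_rpow_le_transportConst_integrand {p : ℝ} (hp : 2 ≤ p) (x : ℝ) :
    (2 : ℝ) ^ (1 - p) ≤ |1 + x| ^ p - |x| ^ p - p * Real.sign x * |x| ^ (p - 1) := by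
  have h1 := abs_half_add_rpow_add_abs_half_sub_rpow_le hp (1 + x) x
  have h2 := (convexOn_abs_rpow (by linarith : 1 ≤ p)).add_deriv_mul_le (Set.mem_univ x)
    (Set.mem_univ ((1 + x + x) / 2)) (hasDerivAt_abs_rpow_sign x (by linarith))
  have e : |(1 + x - x) / 2| ^ p = (2 : ℝ) ^ (1 - p) / 2 := by
    rw [show (1 + x - x) / 2 = (2 : ℝ)⁻¹ by ring, abs_of_pos (by norm_num),
      Real.inv_rpow (by norm_num), Real.rpow_sub (by norm_num), Real.rpow_one]
    field_simp
  rw [e] at h1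
  have e3 : (1 + x + x) / 2 - x = 1 / 2 := by ring
  simp only [e3] at h2
  linarith

theorem transportConst_pos {p : ℝ} (hp : 2 ≤ p) : 0 < transportConst p :=
  lt_of_lt_of_le (by positivity) (le_ciInf (two_rpow_le_transportConst_integrand hp))

/-- Both sides are homogeneous of degree p, so scaling by h = y - x reduces to the defining infimum
evaluated at x / h. -/
theorem transportConst_mul_le {p : ℝ} (hp : 2 ≤ p) (x y : ℝ) :
    transportConst p * |y - x| ^ p
      ≤ |y| ^ p - |x| ^ p - p * Real.sign x * |x| ^ (p - 1) * (y - x) := by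
  rcases eq_or_ne y x with rfl | hne
  · simp [Real.zero_rpow (by linarith : p ≠ 0)]
  set h := y - x
  have hh : h ≠ 0 := sub_ne_zero.2 hne
  have hy : y = x + h := by simp [h]
  have hb : BddBelow (Set.range fun x : ℝ =>
      |1 + x| ^ p - |x| ^ p - p * Real.sign x * |x| ^ (p - 1)) :=
    ⟨_, by rintro _ ⟨z, rfl⟩; exact two_rpow_le_transportConst_integrand hp z⟩
  have hle : transportConst p ≤ _ := ciInf_le hb (x / h)
  have hpos : 0 < |h| := abs_pos.2 hh
  refine (mul_le_mul_of_nonneg_right hle (Real.rpow_nonneg (abs_nonneg h) p)).trans (le_of_eq ?_)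
  have e1 : |1 + x / h| ^ p * |h| ^ p = |y| ^ p := by
    rw [← Real.mul_rpow (abs_nonneg _) (abs_nonneg _), ← abs_mul]
    congr 2; rw [hy]; field_simp; ring
  have e2 : |x / h| ^ p * |h| ^ p = |x| ^ p := by
    rw [← Real.mul_rpow (abs_nonneg _) (abs_nonneg _), ← abs_mul]
    congr 2; field_simp
  have e3 : |x / h| ^ (p - 1) * |h| ^ p = |x| ^ (p - 1) * |h| := by
    have : |h| ^ p = |h| ^ (p - 1) * |h| := by
      rw [← Real.rpow_add_one hpos.ne']; congr 1; ring
    rw [this, ← mul_assoc, ← Real.mul_rpow (abs_nonneg _) (abs_nonneg _), ← abs_mul]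
    congr 3; field_simp
  have e4 : Real.sign (x / h) * |h| = Real.sign x * h := by
    rcases lt_or_gt_of_ne hh with hn | hn
    · rw [abs_of_neg hn]
      rcases lt_trichotomy x 0 with hx | rfl | hx
      · rw [Real.sign_of_neg hx, Real.sign_of_pos (div_pos_of_neg_of_neg hx hn)]; ring
      · simp
      · rw [Real.sign_of_pos hx, Real.sign_of_neg (div_neg_of_pos_of_neg hx hn)]; ring
    · rw [abs_of_pos hn]
      rcases lt_trichotomy x 0 with hx | rfl | hx
      · rw [Real.sign_of_neg hx, Real.sign_of_neg (div_neg_of_neg_of_pos hx hn)]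
      · simp
      · rw [Real.sign_of_pos hx, Real.sign_of_pos (div_pos hx hn)]
  calc _ = |1 + x / h| ^ p * |h| ^ p - |x / h| ^ p * |h| ^ p
        - p * Real.sign (x / h) * (|x / h| ^ (p - 1) * |h| ^ p) := by ring
    _ = |y| ^ p - |x| ^ p - p * (Real.sign (x / h) * |h|) * |x| ^ (p - 1) := by
        rw [e1, e2, e3]; ring
    _ = _ := by rw [e4]; ring

theorem mul_transportConst_le_bregman {V : ℝ → ℝ} (hV : Differentiable ℝ V) {p ρ : ℝ}
    (hp : 2 ≤ p) (hρ : 0 ≤ ρ) (hc : ConvexOn ℝ Set.univ (fun x : ℝ => V x - ρ * |x| ^ p)) (x y : ℝ) :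
    transportConst p * ρ * |y - x| ^ p ≤ bregman V x y := by
  have h1 := hc.add_deriv_mul_le (Set.mem_univ x) (Set.mem_univ y)
    ((hV x).hasDerivAt.sub ((hasDerivAt_abs_rpow_sign x (by linarith : 1 < p)).const_mul ρ))
  have h2 := mul_le_mul_of_nonneg_left (transportConst_mul_le hp x y) hρ
  unfold bregman
  nlinarith

theorem mul_sq_le_bregman {V : ℝ → ℝ} (hV : Differentiable ℝ V) {ρ : ℝ}
    (hc : ConvexOn ℝ Set.univ (fun x : ℝ => V x - ρ * x ^ 2)) (x y : ℝ) :
    ρ * (y - x) ^ 2 ≤ bregman V x y := by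
  have h1 := hc.add_deriv_mul_le (Set.mem_univ x) (Set.mem_univ y)
    ((hV x).hasDerivAt.sub (((hasDerivAt_id x).pow 2).const_mul ρ))
  simp at h1
  unfold bregman
  nlinarith

/-- A `C²` function cannot dominate, up to a convex function, `|x| ^ p` with `p < 2`. -/
theorem two_le_of_convexOn_sub_abs_rpow {V : ℝ → ℝ} (hV : ContDiff ℝ 2 V) {p ρ : ℝ}
    (hp : 1 < p) (hρ : 0 < ρ) (hc : ConvexOn ℝ Set.univ (fun x : ℝ => V x - ρ * |x| ^ p)) :
    2 ≤ p := by
  by_contra! hp2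
  obtain ⟨M, hM⟩ := (isCompact_Icc (a := (-1 : ℝ)) (b := 1)).exists_bound_of_continuousOn
    hV.hasDerivAt_deriv_two.2.continuousOn
  have hd : Differentiable ℝ V := hV.differentiable two_ne_zero
  have upper : ∀ h : ℝ, |h| ≤ 1 → bregman V 0 h ≤ M / 2 * h ^ 2 := by
    intro h hh
    have := bregman_le_of_deriv_two_le hV (c := M) (x := 0) (y := h) fun z hz => by
      rw [abs_le] at hh
      exact (le_abs_self _).trans
        (hM z (Set.uIcc_subset_Icc (by simp) (by simpa using hh) hz))
    simpa using this
  -- The divergence of V from 0 to h is at least ρ h^p by convexity and at most M h² / 2 because V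
  -- is C². For p < 2 this fails as h → 0.
  have key : ∀ h : ℝ, 0 < h → h ≤ 1 → ρ * h ^ p ≤ M / 2 * h ^ 2 := by
    intro h h0 h1
    have hu := upper h (by rw [abs_of_pos h0]; exact h1)
    have hl := hc.add_deriv_mul_le (Set.mem_univ 0) (Set.mem_univ h)
      ((hd 0).hasDerivAt.sub ((hasDerivAt_abs_rpow_sign 0 hp).const_mul ρ))
    simp [Real.zero_rpow (by linarith : p ≠ 0), abs_of_pos h0] at hl
    unfold bregman at hu
    simp at hu
    linarith
  have key2 : ∀ h : ℝ, 0 < h → h ≤ 1 → ρ ≤ M / 2 * h ^ (2 - p) := by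
    intro h h0 h1
    have := key h h0 h1
    have e : h ^ (2 : ℕ) = h ^ (2 - p) * h ^ p := by
      rw [← Real.rpow_add h0, ← Real.rpow_natCast]; congr 1; push_cast; ring
    rw [e, ← mul_assoc] at this
    exact le_of_mul_le_mul_right this (Real.rpow_pos_of_pos h0 p)
  have hlim : Filter.Tendsto (fun h : ℝ => M / 2 * h ^ (2 - p)) (nhdsWithin 0 (Set.Ioi 0))
      (nhds (M / 2 * 0)) := by
    have := (Real.continuousAt_rpow_const 0 (2 - p) (Or.inr (by linarith))).tendsto
    rw [Real.zero_rpow (by linarith)] at this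
    exact (this.mono_left nhdsWithin_le_nhds).const_mul _
  have := ge_of_tendsto hlim (b := ρ) (by
    filter_upwards [Ioc_mem_nhdsGT (zero_lt_one' ℝ)] with h hh
    exact key2 h hh.1 hh.2)
  linarith

theorem convexOn_of_sub_abs_rpow {V : ℝ → ℝ} {p ρ : ℝ} (hp : 1 ≤ p) (hρ : 0 ≤ ρ)
    (hc : ConvexOn ℝ Set.univ (fun x : ℝ => V x - ρ * |x| ^ p)) : ConvexOn ℝ Set.univ V := by
  have := hc.add ((convexOn_abs_rpow hp).smul hρ)
  refine this.congr fun x _ => ?_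
  simp

theorem exists_lower_bound_of_sub_abs_rpow {V : ℝ → ℝ} (hV : Differentiable ℝ V) {p ρ : ℝ}
    (hp : 2 ≤ p) (hρ : 0 < ρ) (hc : ConvexOn ℝ Set.univ (fun x : ℝ => V x - ρ * |x| ^ p)) :
    ∃ m, ∀ y, m ≤ V y := by
  have hT := transportConst_pos hp
  refine bddBelow_of_quadratic (a := V 0 - transportConst p * ρ) (b := deriv V 0)
    (mul_pos hT hρ) fun y => ?_
  have h1 := mul_transportConst_le_bregman hV hp hρ.le hc 0 y
  have h2 : y ^ 2 - 1 ≤ |y| ^ p := by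
    rcases le_total |y| 1 with h | h
    · have : y ^ 2 ≤ 1 := by rw [← sq_abs]; nlinarith [abs_nonneg y]
      linarith [Real.rpow_nonneg (abs_nonneg y) p]
    · have := Real.rpow_le_rpow_of_exponent_le h hp
      rw [Real.rpow_two, sq_abs] at this
      linarith
  have h3 := mul_le_mul_of_nonneg_left h2 (mul_pos hT hρ).le
  unfold bregman at h1
  simp only [sub_zero] at h1
  nlinarith

/-! ### Monotone transport on the line -/

section MonotoneTransport

open Filter Topology ProbabilityTheory

theorem continuous_cdf_of_noAtoms (ν : Measure ℝ) [IsProbabilityMeasure ν]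
    (h : ∀ x : ℝ, ν {x} = 0) : Continuous (cdf ν) := by
  rw [continuous_iff_continuousAt]
  intro x
  rw [(monotone_cdf ν).continuousAt_iff_leftLim_eq_rightLim, StieltjesFunction.rightLim_eq]
  have h1 := h x
  rw [← measure_cdf ν, StieltjesFunction.measure_singleton, ENNReal.ofReal_eq_zero] at h1
  exact le_antisymm ((monotone_cdf ν).leftLim_le le_rfl) (by linarith)

/-- Without atoms the distribution function is continuous and pushes ν to the uniform law on [0, 1].
For 0 < c < 1 the sublevel set is a half-line whose endpoint has value exactly c; for c = 0 it may
be empty, so this case is reached by a limit. -/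
theorem measure_cdf_le (ν : Measure ℝ) [IsProbabilityMeasure ν]
    (h : ∀ x : ℝ, ν {x} = 0) {c : ℝ} (h0 : 0 ≤ c) (h1 : c ≤ 1) :
    ν {x | cdf ν x ≤ c} = ENNReal.ofReal c := by
  have hF := continuous_cdf_of_noAtoms ν h
  have main : ∀ c : ℝ, 0 < c → c < 1 → ν {x | cdf ν x ≤ c} = ENNReal.ofReal c := by
    intro c h0 h1
    have hne : {x | cdf ν x ≤ c}.Nonempty := by
      obtain ⟨x, hx⟩ := ((tendsto_cdf_atBot ν).eventually_lt_const h0).exists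
      exact ⟨x, hx.le⟩
    obtain ⟨B, hB⟩ := ((tendsto_cdf_atTop ν).eventually_const_lt h1).exists
    have hbdd : BddAbove {x | cdf ν x ≤ c} := by
      refine ⟨B, fun x hx => ?_⟩
      by_contra! hlt
      exact absurd (hB.trans_le (monotone_cdf ν hlt.le)) (not_lt.2 hx)
    have hcl : IsClosed {x | cdf ν x ≤ c} := isClosed_le hF continuous_const
    have hmem := hcl.csSup_mem hne hbdd
    set b := sSup {x | cdf ν x ≤ c}
    have hA : {x | cdf ν x ≤ c} = Set.Iic b := by
      ext x
      exact ⟨fun hx => le_csSup hbdd hx, fun hx => (monotone_cdf ν hx).trans hmem⟩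
    have hb : cdf ν b = c := by
      refine le_antisymm hmem ?_
      refine ge_of_tendsto (hF.continuousAt (x := b) |>.tendsto.mono_left
        (nhdsWithin_le_nhds (s := Set.Ioi b))) ?_
      filter_upwards [self_mem_nhdsWithin] with x hx
      by_contra! hlt
      exact absurd (le_csSup hbdd hlt.le) (not_le.2 hx)
    rw [hA, ← ofReal_cdf, hb]
  rcases h0.eq_or_lt with rfl | h0
  · rw [ENNReal.ofReal_zero]
    have hlim : Tendsto (fun c : ℝ => ENNReal.ofReal c) (𝓝[>] 0) (𝓝 0) := by
      have := (ENNReal.continuous_ofReal.tendsto 0).mono_left (nhdsWithin_le_nhds (s := Set.Ioi 0))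
      simpa using this
    refine le_antisymm (ge_of_tendsto hlim ?_) zero_le
    filter_upwards [Ioo_mem_nhdsGT (zero_lt_one' ℝ)] with c hc
    rw [← main c hc.1 hc.2]
    exact measure_mono fun x (hx : _ ≤ _) => hx.trans hc.1.le
  · rcases h1.eq_or_lt with rfl | h1
    · have : {x | cdf ν x ≤ 1} = Set.univ := Set.eq_univ_of_forall fun x => cdf_le_one ν x
      rw [this, measure_univ, ENNReal.ofReal_one]
    · exact main c h0 h1

theorem ae_cdf_mem_Ioo (ν : Measure ℝ) [IsProbabilityMeasure ν]
    (h : ∀ x : ℝ, ν {x} = 0) : ∀ᵐ x ∂ν, 0 < cdf ν x ∧ cdf ν x < 1 := by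
  have h1 : ∀ᵐ x ∂ν, 0 < cdf ν x := by
    rw [ae_iff]
    simpa using measure_cdf_le ν h le_rfl zero_le_one
  have h2 : ∀ᵐ x ∂ν, cdf ν x < 1 := by
    have hm : MeasurableSet {x | cdf ν x < 1} := measurableSet_lt (cdf ν).mono.measurable measurable_const
    refine (mem_ae_iff_prob_eq_one hm).2 (le_antisymm prob_le_one ?_)
    have hlim : Tendsto (fun c : ℝ => ENNReal.ofReal c) (𝓝[<] 1) (𝓝 1) := by
      have := (ENNReal.continuous_ofReal.tendsto 1).mono_left (nhdsWithin_le_nhds (s := Set.Iio 1))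
      simpa using this
    refine le_of_tendsto hlim ?_
    filter_upwards [Ioo_mem_nhdsLT (zero_lt_one' ℝ)] with c hc
    rw [← measure_cdf_le ν h hc.1.le hc.2.le]
    exact measure_mono fun x (hx : _ ≤ _) => lt_of_le_of_lt hx hc.2
  filter_upwards [h1, h2] with x a b using ⟨a, b⟩

/-- The quantile function is adjoint to the distribution function, since right continuity makes the
infimum attained. The bounds 0 < s < 1 make the set nonempty and bounded below, so that `sInf` is
not a default value. -/
theorem sInf_le_cdf_le_iff (μ : Measure ℝ) {s : ℝ} (h0 : 0 < s) (h1 : s < 1) (t : ℝ) :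
    sInf {y | s ≤ cdf μ y} ≤ t ↔ s ≤ cdf μ t := by
  obtain ⟨B, hB⟩ := ((tendsto_cdf_atBot μ).eventually_lt_const h0).exists
  obtain ⟨T, hT⟩ := ((tendsto_cdf_atTop μ).eventually_const_lt h1).exists
  have hbdd : BddBelow {y | s ≤ cdf μ y} := by
    refine ⟨B, fun x hx => ?_⟩
    by_contra! hlt
    exact absurd ((monotone_cdf μ hlt.le).trans_lt hB) (not_lt.2 hx)
  have hne : {y | s ≤ cdf μ y}.Nonempty := ⟨T, hT.le⟩
  refine ⟨fun h => ?_, fun h => csInf_le hbdd h⟩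
  refine le_trans ?_ (monotone_cdf μ h)
  set b := sInf {y | s ≤ cdf μ y}
  refine ge_of_tendsto (((cdf μ).right_continuous b).tendsto.mono_left
    (nhdsWithin_mono b Set.Ioi_subset_Ici_self)) ?_
  filter_upwards [self_mem_nhdsWithin] with x hx
  obtain ⟨y, hy, hyx⟩ := exists_lt_of_csInf_lt hne hx
  exact le_trans hy (monotone_cdf μ hyx.le)

/-- A probability measure without atoms is transported to any other probability measure by a map
which is monotone on a set of full measure. -/
theorem exists_monotone_transport (ν μ : Measure ℝ) [IsProbabilityMeasure ν]
    [IsProbabilityMeasure μ] (h : ∀ x : ℝ, ν {x} = 0) :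
    ∃ θ : ℝ → ℝ, Measurable θ ∧ ν.map θ = μ ∧ ∃ G : Set ℝ, (∀ᵐ x ∂ν, x ∈ G) ∧ MonotoneOn θ G := by
  classical
  set G : Set ℝ := {x | 0 < cdf ν x ∧ cdf ν x < 1} with hG
  have hF : Measurable (cdf ν) := (cdf ν).mono.measurable
  have hGm : MeasurableSet G :=
    (measurableSet_lt measurable_const hF).inter (measurableSet_lt hF measurable_const)
  have hGae := ae_cdf_mem_Ioo ν h
  -- The quantile function of μ composed with the distribution function of ν. The value 0 off the
  -- full-measure set G is arbitrary, which is why monotonicity is claimed only on G.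
  set θ : ℝ → ℝ := fun x => if x ∈ G then sInf {y | cdf ν x ≤ cdf μ y} else 0 with hθ
  have hiff : ∀ x ∈ G, ∀ t, θ x ≤ t ↔ cdf ν x ≤ cdf μ t := by
    intro x hx t
    simp only [hθ, if_pos hx]
    exact sInf_le_cdf_le_iff μ hx.1 hx.2 t
  have hθm : Measurable θ := by
    refine measurable_of_Iic fun t => ?_
    have : θ ⁻¹' Set.Iic t = (G ∩ {x | cdf ν x ≤ cdf μ t}) ∪ (Gᶜ ∩ {x | (0 : ℝ) ≤ t}) := by
      ext x
      by_cases hx : x ∈ G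
      · simp [hx, hiff x hx t]
      · simp [hx, hθ]
    rw [this]
    exact (hGm.inter (measurableSet_le hF measurable_const)).union
      (hGm.compl.inter (MeasurableSet.const _))
  refine ⟨θ, hθm, ?_, G, hGae, ?_⟩
  · have := Measure.isProbabilityMeasure_map (μ := ν) hθm.aemeasurable
    refine Measure.ext_of_Iic _ _ fun t => ?_
    rw [Measure.map_apply hθm measurableSet_Iic, ← ofReal_cdf μ,
      ← measure_cdf_le ν h (cdf_nonneg μ t) (cdf_le_one μ t)]
    refine measure_congr ?_
    filter_upwards [hGae] with x hx
    exact propext (hiff x hx t)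
  · intro x hx y hy hxy
    rw [hiff x hx]
    exact (monotone_cdf ν hxy).trans ((hiff y hy _).1 le_rfl)

end MonotoneTransport

/-! ### Logarithmic energy -/

section LogEnergy

open Filter Topology

/-- The value of the logarithmic energy when it is finite. -/
noncomputable def finiteLogEnergy (V : ℝ → ℝ) (μ : Measure ℝ) : ℝ :=
  (∫ x, V x ∂μ) - ∫ z : ℝ × ℝ, Real.log |z.1 - z.2| ∂(μ.prod μ)

theorem logEnergy_eq_coe {V : ℝ → ℝ} {μ : Measure ℝ} (h : HasFiniteLogEnergy V μ) :
    logEnergy V μ = (finiteLogEnergy V μ : EReal) := by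
  rw [logEnergy, if_pos h, finiteLogEnergy]

theorem logEnergy_eq_top {V : ℝ → ℝ} {μ : Measure ℝ} (h : ¬ HasFiniteLogEnergy V μ) :
    logEnergy V μ = ⊤ := by
  rw [logEnergy, if_neg h]

theorem ae_fst_ne_snd {μ : Measure ℝ} [SFinite μ] (h : ∀ x : ℝ, μ {x} = 0) :
    ∀ᵐ z ∂μ.prod μ, z.1 ≠ z.2 := by
  rw [ae_iff]
  have hs : MeasurableSet {z : ℝ × ℝ | ¬ z.1 ≠ z.2} := by
    simpa using measurableSet_eq_fun measurable_fst measurable_snd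
  rw [Measure.measure_prod_null hs]
  refine Eventually.of_forall fun x => ?_
  simp [h x]

theorem measurable_log_abs_sub :
    Measurable (fun z : ℝ × ℝ => Real.log |z.1 - z.2|) := by
  simp only [Real.log_abs]
  exact Real.measurable_log.comp (measurable_fst.sub measurable_snd)

/-- The uniform law on [0, 1] works: for fixed y, translation bounds the inner integral by that of
|log| over [-1, 1]. This competitor forces the equilibrium measure to have finite energy. -/
theorem exists_hasFiniteLogEnergy {V : ℝ → ℝ} (hV : Continuous V) :
    ∃ ν : Measure ℝ, IsProbabilityMeasure ν ∧ HasFiniteLogEnergy V ν := by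
  set ν : Measure ℝ := volume.restrict (Set.Icc 0 1) with hν
  have hp : IsProbabilityMeasure ν := ⟨by simp [hν]⟩
  refine ⟨ν, hp, hV.integrableOn_Icc, fun x => ?_, measurable_log_abs_sub.aestronglyMeasurable, ?_⟩
  · exact le_antisymm ((Measure.restrict_apply_le _ _).trans (by simp)) zero_le
  set g : ℝ → ℝ≥0∞ := (Set.Icc (-1 : ℝ) 1).indicator fun u => ‖Real.log u‖ₑ with hg
  have hgfin : ∫⁻ u, g u < ∞ := by
    rw [hg, lintegral_indicator measurableSet_Icc]
    have h1 : IntervalIntegrable Real.log volume (-1) 1 := intervalIntegral.intervalIntegrable_log'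
    rw [intervalIntegrable_iff_integrableOn_Icc_of_le (by norm_num)] at h1
    exact h1.2
  have hm : Measurable (fun z : ℝ × ℝ => ‖Real.log |z.1 - z.2|‖ₑ) := measurable_log_abs_sub.enorm
  rw [HasFiniteIntegral, lintegral_prod_symm _ hm.aemeasurable]
  refine lt_of_le_of_lt (lintegral_mono_ae (g := fun _ => ∫⁻ u, g u) ?_) (by simpa using hgfin)
  filter_upwards [ae_restrict_mem (measurableSet_Icc (a := (0 : ℝ)) (b := 1))] with y hy
  rw [← lintegral_sub_right_eq_self g y, hν, ← lintegral_indicator measurableSet_Icc]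
  refine lintegral_mono fun x => ?_
  by_cases hx : x ∈ Set.Icc (0 : ℝ) 1
  · have : x - y ∈ Set.Icc (-1 : ℝ) 1 := ⟨by linarith [hx.1, hy.2], by linarith [hx.2, hy.1]⟩
    simp [hg, Set.indicator_of_mem hx, Set.indicator_of_mem this]
  · simp [Set.indicator_of_notMem hx]

theorem IsEquilibriumMeasure.hasFiniteLogEnergy {V : ℝ → ℝ} (hV : Continuous V) {ν : Measure ℝ}
    (h : IsEquilibriumMeasure V ν) : HasFiniteLogEnergy V ν := by
  obtain ⟨ν₀, hp, hf⟩ := exists_hasFiniteLogEnergy hV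
  by_contra hn
  have := h.2 ν₀ hp
  rw [logEnergy_eq_top hn, logEnergy_eq_coe hf] at this
  simp at this

theorem IsEquilibriumMeasure.finiteLogEnergy_le {V : ℝ → ℝ} {ν μ : Measure ℝ}
    (h : IsEquilibriumMeasure V ν) (hν : HasFiniteLogEnergy V ν) [hp : IsProbabilityMeasure μ]
    (hμ : HasFiniteLogEnergy V μ) : finiteLogEnergy V ν ≤ finiteLogEnergy V μ := by
  have := h.2 μ hp
  rw [logEnergy_eq_coe hν, logEnergy_eq_coe hμ] at this
  exact_mod_cast this

theorem integrable_log_map_iff {ν : Measure ℝ} [SFinite ν] {T : ℝ → ℝ} (hT : Measurable T) :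
    Integrable (fun z : ℝ × ℝ => Real.log |z.1 - z.2|) ((ν.map T).prod (ν.map T)) ↔
      Integrable (fun z : ℝ × ℝ => Real.log |T z.1 - T z.2|) (ν.prod ν) := by
  rw [Measure.map_prod_map ν ν hT hT, integrable_map_measure
    measurable_log_abs_sub.aestronglyMeasurable (hT.prodMap hT).aemeasurable]
  rfl

theorem finiteLogEnergy_map {V : ℝ → ℝ} (hV : Continuous V) {ν : Measure ℝ} [SFinite ν]
    {T : ℝ → ℝ} (hT : Measurable T) :
    finiteLogEnergy V (ν.map T)
      = (∫ x, V (T x) ∂ν) - ∫ z : ℝ × ℝ, Real.log |T z.1 - T z.2| ∂(ν.prod ν) := by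
  rw [finiteLogEnergy, integral_map hT.aemeasurable hV.aestronglyMeasurable,
    Measure.map_prod_map ν ν hT hT, integral_map (hT.prodMap hT).aemeasurable
    measurable_log_abs_sub.aestronglyMeasurable]
  rfl

theorem hasFiniteLogEnergy_map {V : ℝ → ℝ} (hV : Continuous V) {ν : Measure ℝ} [SFinite ν]
    {T : ℝ → ℝ} (hT : Measurable T) (hi : Integrable (fun x => V (T x)) ν)
    (hne : ∀ᵐ z ∂ν.prod ν, T z.1 ≠ T z.2)
    (hl : Integrable (fun z : ℝ × ℝ => Real.log |T z.1 - T z.2|) (ν.prod ν)) :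
    HasFiniteLogEnergy V (ν.map T) := by
  refine ⟨(integrable_map_measure hV.aestronglyMeasurable hT.aemeasurable).2 hi, fun c => ?_,
    (integrable_log_map_iff hT).2 hl⟩
  rw [Measure.map_apply hT (measurableSet_singleton c)]
  have h0 : (ν.prod ν) ((T ⁻¹' {c}) ×ˢ (T ⁻¹' {c})) = 0 := by
    refine measure_mono_null (fun z hz => ?_) hne
    simp only [Set.mem_prod, Set.mem_preimage, Set.mem_singleton_iff] at hz
    simp [hz.1, hz.2]
  rw [Measure.prod_prod] at h0
  exact mul_self_eq_zero.1 h0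

theorem mul_log_le_log_one_add {q t : ℝ} (hq : 0 < q) (h0 : 0 ≤ t) (h1 : t ≤ 1) :
    t * Real.log q ≤ Real.log (1 + t * (q - 1)) := by
  have := strictConcaveOn_log_Ioi.concaveOn.2 (Set.mem_Ioi.2 one_pos) (Set.mem_Ioi.2 hq)
    (sub_nonneg.2 h1) h0 (by ring)
  simp only [smul_eq_mul, Real.log_one, mul_zero, zero_add, mul_one] at this
  rwa [show 1 - t + t * q = 1 + t * (q - 1) by ring] at this

/-- The argument 1 + t(q - 1) lies between 1 and q. This is the domination that makes the
logarithmic energy of every interpolated measure finite. -/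
theorem abs_log_one_add_le {q t : ℝ} (hq : 0 < q) (h0 : 0 ≤ t) (h1 : t ≤ 1) :
    |Real.log (1 + t * (q - 1))| ≤ |Real.log q| := by
  have hl := mul_log_le_log_one_add hq h0 h1
  rcases le_total 1 q with h | h
  · have a : 0 ≤ Real.log q := Real.log_nonneg h
    have b : 1 ≤ 1 + t * (q - 1) := by nlinarith
    rw [abs_of_nonneg a, abs_of_nonneg (Real.log_nonneg b)]
    exact Real.log_le_log (by linarith) (by nlinarith)
  · have a : Real.log q ≤ 0 := Real.log_nonpos hq.le h
    have b : 1 + t * (q - 1) ≤ 1 := by nlinarith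
    have c : 0 < 1 + t * (q - 1) := by nlinarith
    rw [abs_of_nonpos a, abs_of_nonpos (Real.log_nonpos c.le b)]
    nlinarith

theorem interpolate_sub {x y x' y' t : ℝ} (h : 0 < (x' - y') / (x - y)) :
    (x + t * (x' - x)) - (y + t * (y' - y))
      = (x - y) * (1 + t * ((x' - y') / (x - y) - 1)) := by
  have : x - y ≠ 0 := by rintro h0; simp [h0] at h
  field_simp; ring

theorem log_abs_interpolate_sub {x y x' y' t : ℝ} (h : 0 < (x' - y') / (x - y)) (h0 : 0 ≤ t)
    (h1 : t ≤ 1) :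
    0 < 1 + t * ((x' - y') / (x - y) - 1) ∧
    Real.log |(x + t * (x' - x)) - (y + t * (y' - y))|
      = Real.log |x - y| + Real.log (1 + t * ((x' - y') / (x - y) - 1)) := by
  have hne : x - y ≠ 0 := by rintro h0; simp [h0] at h
  have hp : 0 < 1 + t * ((x' - y') / (x - y) - 1) := by
    rcases h1.eq_or_lt with rfl | h1 <;> nlinarith
  refine ⟨hp, ?_⟩
  rw [interpolate_sub h, abs_mul, Real.log_mul (abs_ne_zero.2 hne) (abs_ne_zero.2 hp.ne'),
    Real.log_abs (1 + _)]

theorem log_quotient {a b : ℝ} (h : 0 < b / a) : Real.log (b / a) = Real.log |b| - Real.log |a| := by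
  have hb : b ≠ 0 := by rintro rfl; simp at h
  have ha : a ≠ 0 := by rintro rfl; simp at h
  rw [Real.log_div hb ha, Real.log_abs, Real.log_abs]

end LogEnergy

/-! ### Displacement interpolation and the energy gap -/

section EnergyGap

open Filter Topology

/-- Monotonicity gives only a nonnegative quotient. It is strictly positive because μ has no atoms,
so θ separates almost all pairs of points. -/
theorem ae_quotient_pos {ν μ : Measure ℝ} [SFinite ν] (hν : ∀ x, ν {x} = 0) (hμ : ∀ x, μ {x} = 0)
    {θ : ℝ → ℝ} (hθ : Measurable θ) (hmap : ν.map θ = μ) {G : Set ℝ} (hG : ∀ᵐ x ∂ν, x ∈ G)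
    (hmono : MonotoneOn θ G) : ∀ᵐ z ∂ν.prod ν, 0 < (θ z.1 - θ z.2) / (z.1 - z.2) := by
  have h1 : ∀ᵐ z ∂ν.prod ν, z.1 ∈ G := Measure.quasiMeasurePreserving_fst.ae hG
  have h2 : ∀ᵐ z ∂ν.prod ν, z.2 ∈ G := Measure.quasiMeasurePreserving_snd.ae hG
  have h3 : ∀ᵐ z ∂ν.prod ν, θ z.1 ≠ θ z.2 := by
    have : SFinite μ := by rw [← hmap]; infer_instance
    have := ae_fst_ne_snd hμ
    rw [← hmap, Measure.map_prod_map ν ν hθ hθ] at this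
    exact ae_of_ae_map (hθ.prodMap hθ).aemeasurable this
  filter_upwards [h1, h2, h3, ae_fst_ne_snd hν] with z a b c d
  rcases lt_or_gt_of_ne d with h | h
  · exact div_pos_of_neg_of_neg (sub_neg.2 ((hmono a b h.le).lt_of_ne c)) (sub_neg.2 h)
  · exact div_pos (sub_pos.2 ((hmono b a h.le).lt_of_ne c.symm)) (sub_pos.2 h)

theorem integrable_log_interpolate {ν : Measure ℝ} {θ : ℝ → ℝ} (hθ : Measurable θ)
    (hpos : ∀ᵐ z ∂ν.prod ν, 0 < (θ z.1 - θ z.2) / (z.1 - z.2))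
    (h0 : Integrable (fun z : ℝ × ℝ => Real.log |z.1 - z.2|) (ν.prod ν))
    (h1 : Integrable (fun z : ℝ × ℝ => Real.log |θ z.1 - θ z.2|) (ν.prod ν))
    {t : ℝ} (ht0 : 0 ≤ t) (ht1 : t ≤ 1) :
    Integrable (fun z : ℝ × ℝ => Real.log (1 + t * ((θ z.1 - θ z.2) / (z.1 - z.2) - 1)))
      (ν.prod ν) := by
  refine (h1.sub h0).mono ?_ ?_
  · refine Measurable.aestronglyMeasurable (Real.measurable_log.comp ?_)
    have : Measurable fun z : ℝ × ℝ => (θ z.1 - θ z.2) / (z.1 - z.2) :=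
      ((hθ.comp measurable_fst).sub (hθ.comp measurable_snd)).div (measurable_fst.sub measurable_snd)
    exact ((this.sub_const 1).const_mul t).const_add 1
  · filter_upwards [hpos] with z hz
    rw [Real.norm_eq_abs, Real.norm_eq_abs, Pi.sub_apply, ← log_quotient hz]
    exact abs_log_one_add_le hz ht0 ht1

theorem tendsto_log_one_add_mul_div (q : ℝ) {t : ℕ → ℝ} (ht : Tendsto t atTop (𝓝[≠] 0)) :
    Tendsto (fun n => Real.log (1 + t n * q) / t n) atTop (𝓝 q) := by
  have hd : HasDerivAt (fun s : ℝ => Real.log (1 + s * q)) q 0 := by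
    have h1 : HasDerivAt (fun s : ℝ => 1 + s * q) q 0 := by
      simpa using ((hasDerivAt_id (0 : ℝ)).mul_const q).const_add 1
    simpa using h1.log (by simp)
  have := (hasDerivAt_iff_tendsto_slope.1 hd).comp ht
  refine this.congr fun n => ?_
  simp [slope_def_field]

theorem tendsto_comp_add_mul_sub_div {V : ℝ → ℝ} (hV : Differentiable ℝ V) (x h : ℝ) {t : ℕ → ℝ}
    (ht : Tendsto t atTop (𝓝[≠] 0)) :
    Tendsto (fun n => (V (x + t n * h) - V x) / t n) atTop (𝓝 (deriv V x * h)) := by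
  have hd : HasDerivAt (fun s : ℝ => V (x + s * h)) (deriv V x * h) 0 := by
    have h1 : HasDerivAt (fun s : ℝ => x + s * h) h 0 := by
      simpa using ((hasDerivAt_id (0 : ℝ)).mul_const h).const_add x
    have h2 : HasDerivAt V (deriv V x) (x + 0 * h) := by simpa using (hV x).hasDerivAt
    exact h2.comp 0 h1
  have := (hasDerivAt_iff_tendsto_slope.1 hd).comp ht
  refine this.congr fun n => ?_
  simp [slope_def_field]

/-- The energy gap dominates the defect of displacement convexity along a monotone transport. -/
theorem exists_transport_lintegral_le {V : ℝ → ℝ} (hV : Differentiable ℝ V)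
    (hc : ConvexOn ℝ Set.univ V) (hb : ∃ m, ∀ x, m ≤ V x) {ν : Measure ℝ}
    (hν : IsEquilibriumMeasure V ν) (μ : Measure ℝ) [IsProbabilityMeasure μ]
    (hμ : HasFiniteLogEnergy V μ) :
    ∃ θ : ℝ → ℝ, Measurable θ ∧ ν.map θ = μ ∧
      (∀ᵐ z ∂ν.prod ν, 0 < (θ z.1 - θ z.2) / (z.1 - z.2)) ∧
      ∫⁻ z, ENNReal.ofReal (bregman V z.1 (θ z.1) +
          ((θ z.1 - θ z.2) / (z.1 - z.2) - 1 - Real.log ((θ z.1 - θ z.2) / (z.1 - z.2))))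
        ∂(ν.prod ν) ≤ ENNReal.ofReal (finiteLogEnergy V μ - finiteLogEnergy V ν) := by
  have hcV := hV.continuous
  have hf := hν.hasFiniteLogEnergy hcV
  have := hν.1
  obtain ⟨θ, hθ, hmap, G, hG, hmono⟩ := exists_monotone_transport ν μ hf.2.1
  have hpos := ae_quotient_pos hf.2.1 hμ.2.1 hθ hmap hG hmono
  refine ⟨θ, hθ, hmap, hpos, ?_⟩
  obtain ⟨m, hm⟩ := hb
  have hl0 := hf.2.2
  have hl1 : Integrable (fun z : ℝ × ℝ => Real.log |θ z.1 - θ z.2|) (ν.prod ν) := by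
    rw [← integrable_log_map_iff hθ, hmap]; exact hμ.2.2
  have hV1 : Integrable (fun x => V (θ x)) ν := by
    have := hμ.1
    rw [← hmap] at this
    exact (integrable_map_measure hcV.aestronglyMeasurable hθ.aemeasurable).1 this
  have hEμ : finiteLogEnergy V μ = (∫ x, V (θ x) ∂ν) - ∫ z : ℝ × ℝ, Real.log |θ z.1 - θ z.2| ∂(ν.prod ν) := by
    rw [← hmap, finiteLogEnergy_map hcV hθ]
  have hqm : Measurable fun z : ℝ × ℝ => (θ z.1 - θ z.2) / (z.1 - z.2) :=
    ((hθ.comp measurable_fst).sub (hθ.comp measurable_snd)).div (measurable_fst.sub measurable_snd)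
  set g : ℝ → ℝ × ℝ → ℝ := fun t z =>
    (V (θ z.1) - V z.1 - (V (z.1 + t * (θ z.1 - z.1)) - V z.1) / t) +
      (Real.log (1 + t * ((θ z.1 - θ z.2) / (z.1 - z.2) - 1)) / t
        - Real.log ((θ z.1 - θ z.2) / (z.1 - z.2))) with hg
  have hTm : ∀ t : ℝ, Measurable fun x => x + t * (θ x - x) := fun t =>
    measurable_id.add ((hθ.sub measurable_id).const_mul t)
  have hgm : ∀ t, Measurable (g t) := by
    intro t
    have a1 : Measurable fun z : ℝ × ℝ => V (θ z.1) := hcV.measurable.comp (hθ.comp measurable_fst)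
    have a2 : Measurable fun z : ℝ × ℝ => V z.1 := hcV.measurable.comp measurable_fst
    have a3 : Measurable fun z : ℝ × ℝ => V (z.1 + t * (θ z.1 - z.1)) :=
      hcV.measurable.comp ((hTm t).comp measurable_fst)
    have a4 : Measurable fun z : ℝ × ℝ => Real.log (1 + t * ((θ z.1 - θ z.2) / (z.1 - z.2) - 1)) :=
      Real.measurable_log.comp (((hqm.sub_const 1).const_mul t).const_add 1)
    exact ((a1.sub a2).sub ((a3.sub a2).div_const t)).add
      ((a4.div_const t).sub (Real.measurable_log.comp hqm))
  have main : ∀ t : ℝ, 0 < t → t ≤ 1 →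
      ∫⁻ z, ENNReal.ofReal (g t z) ∂(ν.prod ν)
        ≤ ENNReal.ofReal (finiteLogEnergy V μ - finiteLogEnergy V ν) := by
    intro t ht0 ht1
    have hconv : ∀ x, V (x + t * (θ x - x)) ≤ (1 - t) * V x + t * V (θ x) := by
      intro x
      have := hc.2 (Set.mem_univ x) (Set.mem_univ (θ x)) (sub_nonneg.2 ht1) ht0.le (by ring)
      simp only [smul_eq_mul] at this
      rwa [show (1 - t) * x + t * θ x = x + t * (θ x - x) by ring] at this
    have hlog := integrable_log_interpolate hθ hpos hl0 hl1 ht0.le ht1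
    -- Convexity bounds the integrand above, and the global lower bound on V bounds it below.
    have hVt : Integrable (fun x => V (x + t * (θ x - x))) ν := by
      refine integrable_of_le_of_le (hcV.measurable.comp (hTm t)).aestronglyMeasurable
        (Eventually.of_forall fun x => hm _) (Eventually.of_forall hconv) (integrable_const m)
        ((hf.1.const_mul _).add (hV1.const_mul _))
    have hae : (fun z : ℝ × ℝ => Real.log |(z.1 + t * (θ z.1 - z.1)) - (z.2 + t * (θ z.2 - z.2))|)
        =ᵐ[ν.prod ν] fun z => Real.log |z.1 - z.2| +
          Real.log (1 + t * ((θ z.1 - θ z.2) / (z.1 - z.2) - 1)) := by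
      filter_upwards [hpos] with z hz using (log_abs_interpolate_sub hz ht0.le ht1).2
    have hfin : HasFiniteLogEnergy V (ν.map fun x => x + t * (θ x - x)) := by
      refine hasFiniteLogEnergy_map hcV (hTm t) hVt ?_ ((hl0.add hlog).congr hae.symm)
      filter_upwards [hpos] with z hz
      have hne : z.1 - z.2 ≠ 0 := by intro h0; simp [h0] at hz
      rw [← sub_ne_zero, interpolate_sub hz]
      exact mul_ne_zero hne (log_abs_interpolate_sub hz ht0.le ht1).1.ne'
    have := Measure.isProbabilityMeasure_map (μ := ν) (hTm t).aemeasurable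
    have hmin := hν.finiteLogEnergy_le hf hfin
    rw [finiteLogEnergy_map hcV (hTm t), integral_congr_ae hae, integral_add hl0 hlog,
      finiteLogEnergy] at hmin
    have hfst : ∀ f : ℝ → ℝ, Integrable f ν → Integrable (fun z : ℝ × ℝ => f z.1) (ν.prod ν) :=
      fun f hf => hf.comp_fst ν
    have hint : ∀ f : ℝ → ℝ, ∫ z : ℝ × ℝ, f z.1 ∂(ν.prod ν) = ∫ x, f x ∂ν := by
      intro f
      rw [integral_fun_fst]; simp
    have haeq : (fun z : ℝ × ℝ => Real.log ((θ z.1 - θ z.2) / (z.1 - z.2))) =ᵐ[ν.prod ν]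
        fun z => Real.log |θ z.1 - θ z.2| - Real.log |z.1 - z.2| := by
      filter_upwards [hpos] with z hz using log_quotient hz
    have hlq : Integrable (fun z : ℝ × ℝ => Real.log ((θ z.1 - θ z.2) / (z.1 - z.2))) (ν.prod ν) :=
      (hl1.sub hl0).congr haeq.symm
    have i1 : Integrable (fun x => V (θ x) - V x - (V (x + t * (θ x - x)) - V x) / t) ν :=
      (hV1.sub hf.1).sub ((hVt.sub hf.1).div_const t)
    have i2 : Integrable (fun z : ℝ × ℝ => Real.log (1 + t * ((θ z.1 - θ z.2) / (z.1 - z.2) - 1)) / t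
        - Real.log ((θ z.1 - θ z.2) / (z.1 - z.2))) (ν.prod ν) := (hlog.div_const t).sub hlq
    have hgi : Integrable (g t) (ν.prod ν) := (hfst _ i1).add i2
    have hg0 : 0 ≤ᵐ[ν.prod ν] g t := by
      filter_upwards [hpos] with z hz
      have e1 := hconv z.1
      have e2 := mul_log_le_log_one_add hz ht0.le ht1
      have e3 : (V (z.1 + t * (θ z.1 - z.1)) - V z.1) / t ≤ V (θ z.1) - V z.1 := by
        rw [div_le_iff₀ ht0]; linarith
      have e4 : Real.log ((θ z.1 - θ z.2) / (z.1 - z.2)) ≤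
          Real.log (1 + t * ((θ z.1 - θ z.2) / (z.1 - z.2) - 1)) / t := by
        rw [le_div_iff₀ ht0]; linarith
      simp only [hg, Pi.zero_apply]
      linarith
    rw [← ofReal_integral_eq_lintegral_ofReal hgi hg0]
    refine ENNReal.ofReal_le_ofReal ?_
    have iV : Integrable (fun x => V (θ x) - V x) ν := hV1.sub hf.1
    have iVt : Integrable (fun x => (V (x + t * (θ x - x)) - V x) / t) ν := (hVt.sub hf.1).div_const t
    have j1 : ∫ x, (V (θ x) - V x - (V (x + t * (θ x - x)) - V x) / t) ∂ν
        = (∫ x, V (θ x) ∂ν) - (∫ x, V x ∂ν)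
          - ((∫ x, V (x + t * (θ x - x)) ∂ν) - ∫ x, V x ∂ν) / t := by
      rw [integral_sub iV iVt, integral_sub hV1 hf.1, integral_div, integral_sub hVt hf.1]
    have j2 : ∫ z : ℝ × ℝ, (Real.log (1 + t * ((θ z.1 - θ z.2) / (z.1 - z.2) - 1)) / t
          - Real.log ((θ z.1 - θ z.2) / (z.1 - z.2))) ∂(ν.prod ν)
        = (∫ z : ℝ × ℝ, Real.log (1 + t * ((θ z.1 - θ z.2) / (z.1 - z.2) - 1)) ∂(ν.prod ν)) / t
          - ((∫ z : ℝ × ℝ, Real.log |θ z.1 - θ z.2| ∂(ν.prod ν))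
            - ∫ z : ℝ × ℝ, Real.log |z.1 - z.2| ∂(ν.prod ν)) := by
      rw [integral_sub (hlog.div_const t) hlq, integral_div, integral_congr_ae haeq,
        integral_sub hl1 hl0]
    have hval : ∫ z, g t z ∂(ν.prod ν) = ((∫ x, V (θ x) ∂ν) - (∫ x, V x ∂ν)
          - ((∫ x, V (x + t * (θ x - x)) ∂ν) - ∫ x, V x ∂ν) / t)
        + ((∫ z : ℝ × ℝ, Real.log (1 + t * ((θ z.1 - θ z.2) / (z.1 - z.2) - 1)) ∂(ν.prod ν)) / t
          - ((∫ z : ℝ × ℝ, Real.log |θ z.1 - θ z.2| ∂(ν.prod ν))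
            - ∫ z : ℝ × ℝ, Real.log |z.1 - z.2| ∂(ν.prod ν))) := by
      simp only [hg]
      rw [integral_add (hfst _ i1) i2, hint (fun x => V (θ x) - V x - (V (x + t * (θ x - x)) - V x) / t),
        j1, j2]
    rw [hval, hEμ, finiteLogEnergy]
    -- This is where minimality of ν enters: the energy quotient between times 0 and t is
    -- nonnegative.
    have : 0 ≤ ((∫ x, V (x + t * (θ x - x)) ∂ν) - ∫ x, V x ∂ν) / t
        - (∫ z : ℝ × ℝ, Real.log (1 + t * ((θ z.1 - θ z.2) / (z.1 - z.2) - 1)) ∂(ν.prod ν)) / t := by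
      rw [← sub_div]
      exact div_nonneg (by linarith) ht0.le
    linarith
  set t : ℕ → ℝ := fun n => 1 / ((n : ℝ) + 1) with ht
  have htpos : ∀ n, 0 < t n := fun n => by positivity
  have htlim : Tendsto t atTop (𝓝[≠] 0) :=
    tendsto_nhdsWithin_iff.2 ⟨tendsto_one_div_add_atTop_nhds_zero_nat,
      Eventually.of_forall fun n => (htpos n).ne'⟩
  have hlim : ∀ z : ℝ × ℝ, Tendsto (fun n => ENNReal.ofReal (g (t n) z)) atTop
      (𝓝 (ENNReal.ofReal (bregman V z.1 (θ z.1) +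
          ((θ z.1 - θ z.2) / (z.1 - z.2) - 1 - Real.log ((θ z.1 - θ z.2) / (z.1 - z.2)))))) := by
    intro z
    refine (ENNReal.continuous_ofReal.tendsto _).comp ?_
    exact (tendsto_const_nhds.sub (tendsto_comp_add_mul_sub_div hV z.1 (θ z.1 - z.1) htlim)).add
      ((tendsto_log_one_add_mul_div _ htlim).sub tendsto_const_nhds)
  -- Fatou's lemma replaces differentiation under the integral, so V'(θ - id) and q need not be
  -- known to be integrable.
  calc _ = ∫⁻ z, liminf (fun n => ENNReal.ofReal (g (t n) z)) atTop ∂(ν.prod ν) :=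
        lintegral_congr fun z => (hlim z).liminf_eq.symm
    _ ≤ liminf (fun n => ∫⁻ z, ENNReal.ofReal (g (t n) z) ∂(ν.prod ν)) atTop :=
        lintegral_liminf_le fun n => (hgm (t n)).ennreal_ofReal
    _ ≤ _ := by
        refine liminf_le_of_le (by isBoundedDefault) fun b hb => ?_
        obtain ⟨n, hn⟩ := hb.exists
        refine hn.trans (main (t n) (htpos n) ?_)
        simp only [ht]
        rw [div_le_one (by positivity)]
        have : (0 : ℝ) ≤ n := n.cast_nonneg
        linarith

end EnergyGap

/-! ### Transport inequalities from lower bounds on the displacement convexity defect -/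

/-- The coupling carried by the graph of θ is one admissible choice; its optimality is never needed.
-/
theorem wassersteinDist_rpow_le {ν : Measure ℝ} [IsProbabilityMeasure ν] {θ : ℝ → ℝ}
    (hθ : Measurable θ) {p : ℝ} (hp : 0 < p) :
    wassersteinDist p (ν.map θ) ν ^ p ≤ ∫⁻ x, ENNReal.ofReal (|θ x - x| ^ p) ∂ν := by
  have hm : Measurable fun x => (θ x, x) := hθ.prodMk measurable_id
  have hmem : ν.map (fun x => (θ x, x)) ∈ couplings (ν.map θ) ν :=
    ⟨Measure.isProbabilityMeasure_map hm.aemeasurable, by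
      rw [Measure.map_map measurable_fst hm]; rfl, by
      rw [Measure.map_map measurable_snd hm]; exact Measure.map_id⟩
  have hle : wassersteinDist p (ν.map θ) ν ≤ _ := iInf₂_le _ hmem
  refine (ENNReal.rpow_le_rpow hle hp.le).trans (le_of_eq ?_)
  rw [← ENNReal.rpow_mul, one_div_mul_cancel hp.ne', ENNReal.rpow_one, lintegral_map _ hm]
  exact ((((measurable_fst.sub measurable_snd).abs).pow_const p)).ennreal_ofReal

/-- A transport inequality follows from a lower bound on the defect of displacement convexity. -/
theorem mul_wassersteinDist_rpow_le_sub {V : ℝ → ℝ} (hV : Differentiable ℝ V)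
    (hc : ConvexOn ℝ Set.univ V) (hb : ∃ m, ∀ x, m ≤ V x) {ν : Measure ℝ}
    (hν : IsEquilibriumMeasure V ν) {p C : ℝ} (hp : 0 < p)
    (h : ∀ θ : ℝ → ℝ, Measurable θ → (∀ᵐ z ∂ν.prod ν, 0 < (θ z.1 - θ z.2) / (z.1 - z.2)) →
      ENNReal.ofReal C * ∫⁻ x, ENNReal.ofReal (|θ x - x| ^ p) ∂ν
        ≤ ∫⁻ z, ENNReal.ofReal (bregman V z.1 (θ z.1) +
          ((θ z.1 - θ z.2) / (z.1 - z.2) - 1 - Real.log ((θ z.1 - θ z.2) / (z.1 - z.2))))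
        ∂(ν.prod ν))
    (μ : Measure ℝ) (hμ : IsProbabilityMeasure μ) :
    ((ENNReal.ofReal C * wassersteinDist p μ ν ^ p : ℝ≥0∞) : EReal)
      ≤ logEnergy V μ - logEnergy V ν := by
  have := hν.1
  have hf := hν.hasFiniteLogEnergy hV.continuous
  rw [logEnergy_eq_coe hf]
  by_cases hfμ : HasFiniteLogEnergy V μ
  · obtain ⟨θ, hθ, rfl, hpos, hle⟩ := exists_transport_lintegral_le hV hc hb hν μ hfμ
    have h1 : ENNReal.ofReal C * wassersteinDist p (ν.map θ) ν ^ p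
        ≤ ENNReal.ofReal (finiteLogEnergy V (ν.map θ) - finiteLogEnergy V ν) :=
      (mul_le_mul_right (wassersteinDist_rpow_le hθ hp) _).trans ((h θ hθ hpos).trans hle)
    rw [logEnergy_eq_coe hfμ, ← EReal.coe_sub]
    refine (EReal.coe_ennreal_le_coe_ennreal_iff.2 h1).trans (le_of_eq ?_)
    rw [EReal.coe_ennreal_ofReal, max_eq_left (sub_nonneg.2 (hν.finiteLogEnergy_le hf hfμ))]
  · rw [logEnergy_eq_top hfμ, EReal.top_sub_coe]
    exact le_top

theorem mul_wassersteinDist_rpow_le_sub_of_bregman {V : ℝ → ℝ} (hV : Differentiable ℝ V)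
    (hc : ConvexOn ℝ Set.univ V) (hb : ∃ m, ∀ x, m ≤ V x) {ν : Measure ℝ}
    (hν : IsEquilibriumMeasure V ν) {p C : ℝ} (hp : 0 < p) (hC : 0 ≤ C)
    (h : ∀ x y, C * |y - x| ^ p ≤ bregman V x y) (μ : Measure ℝ) (hμ : IsProbabilityMeasure μ) :
    ((ENNReal.ofReal C * wassersteinDist p μ ν ^ p : ℝ≥0∞) : EReal)
      ≤ logEnergy V μ - logEnergy V ν := by
  have := hν.1
  refine mul_wassersteinDist_rpow_le_sub hV hc hb hν hp (fun θ hθ hpos => ?_) μ hμ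
  have hm : Measurable fun x => ENNReal.ofReal (|θ x - x| ^ p) :=
    (((hθ.sub measurable_id).abs).pow_const p).ennreal_ofReal
  have e : ∫⁻ x, ENNReal.ofReal (|θ x - x| ^ p) ∂ν
      = ∫⁻ z : ℝ × ℝ, ENNReal.ofReal (|θ z.1 - z.1| ^ p) ∂(ν.prod ν) :=
    (measurePreserving_fst (μ := ν) (ν := ν)).lintegral_comp hm |>.symm
  have hm' : Measurable fun z : ℝ × ℝ => ENNReal.ofReal (|θ z.1 - z.1| ^ p) := hm.comp measurable_fst
  rw [e, ← lintegral_const_mul _ hm']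
  refine lintegral_mono_ae ?_
  filter_upwards [hpos] with z hz
  rw [← ENNReal.ofReal_mul hC]
  refine ENNReal.ofReal_le_ofReal ?_
  linarith [h z.1 (θ z.1), Real.log_le_sub_one_of_pos hz]

/-! ### Translates in a quadratic field -/

theorem ofReal_integral_le_lintegral_ofReal {α : Type*} [MeasurableSpace α] {μ : Measure α}
    {f : α → ℝ} (hf : Integrable f μ) :
    ENNReal.ofReal (∫ x, f x ∂μ) ≤ ∫⁻ x, ENNReal.ofReal (f x) ∂μ := by
  refine ENNReal.ofReal_le_of_le_toReal ?_
  rw [integral_eq_lintegral_pos_part_sub_lintegral_neg_part hf]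
  exact sub_le_self _ ENNReal.toReal_nonneg

/-- Under every coupling the mean of the difference of the coordinates is m. Integrating the tangent
bound u² ≥ 2mu - m² then gives m². -/
theorem ofReal_sq_le_wassersteinDist_two_sq {ν : Measure ℝ} [IsProbabilityMeasure ν]
    (hi : Integrable (fun x : ℝ => x) ν) (m : ℝ) :
    ENNReal.ofReal (m ^ 2) ≤ wassersteinDist 2 (ν.map fun x => x + m) ν ^ 2 := by
  have key : ∀ π ∈ couplings (ν.map fun x => x + m) ν,
      ENNReal.ofReal (m ^ 2) ≤ ∫⁻ z : ℝ × ℝ, ENNReal.ofReal (|z.1 - z.2| ^ (2 : ℝ)) ∂π := by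
    rintro π ⟨hπ, h1, h2⟩
    have hT : Measurable fun x : ℝ => x + m := measurable_id.add_const m
    have hid : Measurable fun x : ℝ => x := measurable_id
    have i2 : Integrable (fun z : ℝ × ℝ => z.2) π := by
      rw [← h2] at hi
      exact hi.comp_measurable measurable_snd
    have hi1 : Integrable (fun x : ℝ => x) (ν.map fun x => x + m) :=
      (integrable_map_measure aestronglyMeasurable_id hT.aemeasurable).2
        (hi.add (integrable_const m))
    have i1 : Integrable (fun z : ℝ × ℝ => z.1) π := by
      rw [← h1] at hi1
      exact hi1.comp_measurable measurable_fst
    have e2 : ∫ z : ℝ × ℝ, z.2 ∂π = ∫ x, x ∂ν := by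
      conv_rhs => rw [← h2]
      rw [integral_map measurable_snd.aemeasurable hid.aestronglyMeasurable]
    have e1 : ∫ z : ℝ × ℝ, z.1 ∂π = (∫ x, x ∂ν) + m := by
      have : ∫ x, x ∂(ν.map fun x => x + m) = (∫ x, x ∂ν) + m := by
        rw [integral_map hT.aemeasurable hid.aestronglyMeasurable, integral_add hi (integrable_const m)]
        simp
      rw [← this, ← h1, integral_map measurable_fst.aemeasurable hid.aestronglyMeasurable]
    have i3 : Integrable (fun z : ℝ × ℝ => 2 * m * (z.1 - z.2) - m ^ 2) π :=
      ((i1.sub i2).const_mul _).sub (integrable_const _)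
    have i4 : Integrable (fun z : ℝ × ℝ => 2 * m * (z.1 - z.2)) π := (i1.sub i2).const_mul _
    have e3 : ∫ z : ℝ × ℝ, (2 * m * (z.1 - z.2) - m ^ 2) ∂π = m ^ 2 := by
      rw [integral_sub i4 (integrable_const _), integral_const_mul,
        integral_sub i1 i2, e1, e2]
      simp; ring
    rw [← e3]
    refine (ofReal_integral_le_lintegral_ofReal i3).trans (lintegral_mono fun z => ?_)
    refine ENNReal.ofReal_le_ofReal ?_
    rw [Real.rpow_two, sq_abs]
    nlinarith [sq_nonneg (z.1 - z.2 - m)]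
  have h3 : ENNReal.ofReal (m ^ 2) ^ (1 / 2 : ℝ) ≤ wassersteinDist 2 (ν.map fun x => x + m) ν :=
    le_iInf₂ fun π hπ => ENNReal.rpow_le_rpow (key π hπ) (by norm_num)
  calc ENNReal.ofReal (m ^ 2) = (ENNReal.ofReal (m ^ 2) ^ (1 / 2 : ℝ)) ^ 2 := by
        rw [← ENNReal.rpow_two, ← ENNReal.rpow_mul]; norm_num
    _ ≤ _ := by gcongr

theorem quadratic_translate {V : ℝ → ℝ} {ν : Measure ℝ} (hν : IsEquilibriumMeasure V ν) {ρ : ℝ}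
    (hρ : 0 < ρ) (hV : ∀ x, V x = ρ * x ^ 2) :
    Integrable (fun x : ℝ => x) ν ∧ ∀ m : ℝ,
      logEnergy V (ν.map fun x => x + m) - logEnergy V ν = ((ρ * m ^ 2 : ℝ) : EReal) := by
  have := hν.1
  have hcV : Continuous V := by rw [funext hV]; fun_prop
  have hf := hν.hasFiniteLogEnergy hcV
  have hi2 : Integrable (fun x : ℝ => x ^ 2) ν := by
    have := hf.1.const_mul ρ⁻¹
    refine this.congr (Filter.Eventually.of_forall fun x => ?_)
    simp only [hV]; field_simp
  have hi : Integrable (fun x : ℝ => x) ν := by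
    refine (hi2.add (integrable_const 1)).mono aestronglyMeasurable_id
      (Filter.Eventually.of_forall fun x => ?_)
    simp only [Real.norm_eq_abs, Pi.add_apply]
    rw [abs_of_nonneg (by positivity : 0 ≤ x ^ 2 + 1), ← sq_abs]
    nlinarith [sq_nonneg (|x| - 1), abs_nonneg x]
  refine ⟨hi, ?_⟩
  have hT : ∀ m : ℝ, Measurable fun x : ℝ => x + m := fun m => measurable_id.add_const m
  have hVe : ∀ m : ℝ, (fun x => V (x + m)) = fun x => V x + (2 * ρ * m * x + ρ * m ^ 2) := by
    intro m; funext x; rw [hV, hV]; ring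
  have hiV : ∀ m : ℝ, Integrable (fun x => 2 * ρ * m * x + ρ * m ^ 2) ν := fun m =>
    (hi.const_mul _).add (integrable_const _)
  have hfin : ∀ m : ℝ, HasFiniteLogEnergy V (ν.map fun x => x + m) := by
    intro m
    refine hasFiniteLogEnergy_map hcV (hT m) ?_ ?_ ?_
    · rw [hVe]; exact hf.1.add (hiV m)
    · simpa using ae_fst_ne_snd hf.2.1
    · simpa using hf.2.2
  have hval : ∀ m : ℝ, finiteLogEnergy V (ν.map fun x => x + m)
      = finiteLogEnergy V ν + (2 * ρ * m * (∫ x, x ∂ν) + ρ * m ^ 2) := by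
    intro m
    rw [finiteLogEnergy_map hcV (hT m), hVe, integral_add hf.1 (hiV m),
      integral_add (hi.const_mul _) (integrable_const _), integral_const_mul, finiteLogEnergy]
    simp
    ring
  -- Translating by minus the mean a changes the energy by -ρa², so minimality forces a = 0.
  have hmean : ∫ x, x ∂ν = 0 := by
    set a := ∫ x, x ∂ν
    have := Measure.isProbabilityMeasure_map (μ := ν) (hT (-a)).aemeasurable
    have h1 := hν.finiteLogEnergy_le hf (hfin (-a))
    rw [hval] at h1
    have h2 : ρ * a ^ 2 ≤ 0 := by linarith
    have h3 : a ^ 2 ≤ 0 := by nlinarith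
    exact pow_eq_zero_iff two_ne_zero |>.1 (le_antisymm h3 (sq_nonneg a))
  intro m
  rw [logEnergy_eq_coe (hfin m), logEnergy_eq_coe hf, ← EReal.coe_sub, hval, hmean]
  congr 1; ring

/-! ### First variation of the energy -/

section FirstVariation

open Filter Topology

theorem sub_two_mul_sq_le_log_one_add {s : ℝ} (hs : |s| ≤ 1 / 2) :
    s - 2 * s ^ 2 ≤ Real.log (1 + s) := by
  rw [abs_le] at hs
  have hp : 0 < 1 + s := by linarith
  have h1 := Real.one_sub_inv_le_log_of_pos hp
  refine le_trans ?_ h1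
  rw [← sub_nonneg]
  have : 1 - (1 + s)⁻¹ - (s - 2 * s ^ 2) = s ^ 2 * (1 + 2 * s) / (1 + s) := by
    field_simp; ring
  rw [this]
  exact div_nonneg (mul_nonneg (sq_nonneg s) (by linarith)) hp.le

/-- The first variation of the energy at a compactly supported equilibrium measure. -/
theorem integral_quotient_le_integral_deriv_mul {V : ℝ → ℝ} (hV : ContDiff ℝ 2 V) {ν : Measure ℝ}
    (hν : IsEquilibriumMeasure V ν) {K : Set ℝ} (hK : ∀ᵐ x ∂ν, x ∈ K) {r : ℝ}
    (hKr : ∀ x ∈ K, |x| ≤ r) {h : ℝ → ℝ} (hm : Measurable h) {B L : ℝ}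
    (hB : ∀ x ∈ K, |h x| ≤ B) (hL : ∀ x ∈ K, ∀ y ∈ K, |h x - h y| ≤ L * |x - y|) :
    Integrable (fun z : ℝ × ℝ => (h z.1 - h z.2) / (z.1 - z.2)) (ν.prod ν) ∧
    Integrable (fun x => deriv V x * h x) ν ∧
    ∫ z : ℝ × ℝ, (h z.1 - h z.2) / (z.1 - z.2) ∂(ν.prod ν) ≤ ∫ x, deriv V x * h x ∂ν := by
  have hcV := hV.continuous
  have hcd : Continuous (deriv V) := hV.hasDerivAt_deriv_two.1.continuous
  have hf := hν.hasFiniteLogEnergy hcV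
  have := hν.1
  obtain ⟨M, hM⟩ := (isCompact_Icc (a := -(r + 1)) (b := r + 1)).exists_bound_of_continuousOn
    hV.hasDerivAt_deriv_two.2.continuousOn
  obtain ⟨M₀, hM₀⟩ := (isCompact_Icc (a := -(r + 1)) (b := r + 1)).exists_bound_of_continuousOn
    hcV.continuousOn
  obtain ⟨M₁, hM₁⟩ := (isCompact_Icc (a := -(r + 1)) (b := r + 1)).exists_bound_of_continuousOn
    hcd.continuousOn
  have hK1 : ∀ᵐ z ∂ν.prod ν, z.1 ∈ K := Measure.quasiMeasurePreserving_fst.ae hK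
  have hK2 : ∀ᵐ z ∂ν.prod ν, z.2 ∈ K := Measure.quasiMeasurePreserving_snd.ae hK
  set u : ℝ × ℝ → ℝ := fun z => (h z.1 - h z.2) / (z.1 - z.2) with hu
  have hum : Measurable u :=
    ((hm.comp measurable_fst).sub (hm.comp measurable_snd)).div (measurable_fst.sub measurable_snd)
  set L' := max L 0 with hL'
  have huL : ∀ᵐ z ∂ν.prod ν, |u z| ≤ L' := by
    filter_upwards [hK1, hK2, ae_fst_ne_snd hf.2.1] with z a b c
    have hp : 0 < |z.1 - z.2| := abs_pos.2 (sub_ne_zero.2 c)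
    simp only [hu]
    rw [abs_div, div_le_iff₀ hp]
    exact (hL _ a _ b).trans (mul_le_mul_of_nonneg_right (le_max_left _ _) hp.le)
  have hui : Integrable u (ν.prod ν) := Integrable.of_bound hum.aestronglyMeasurable L' huL
  have hVh : Integrable (fun x => deriv V x * h x) ν := by
    refine Integrable.of_bound (hcd.measurable.mul hm).aestronglyMeasurable (M₁ * B) ?_
    filter_upwards [hK] with x hx
    have hx' := abs_le.1 (hKr x hx)
    rw [norm_mul]
    have h1 := hM₁ x ⟨by linarith, by linarith⟩
    exact mul_le_mul h1 (hB x hx) (norm_nonneg _) ((norm_nonneg _).trans h1)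
  refine ⟨hui, hVh, ?_⟩
  set a := ∫ z, u z ∂(ν.prod ν)
  set b := ∫ x, deriv V x * h x ∂ν
  -- Compare ν with its image under x + t h(x) and expand to second order. The condition on tB keeps
  -- the moved points in [-(r + 1), r + 1], where V'' is bounded by M; the one on tL' allows the
  -- quadratic lower bound for the logarithm. Dividing by t and letting t → 0 removes the remainder.
  have main : ∀ t : ℝ, 0 < t → t * B ≤ 1 → t * L' ≤ 1 / 2 →
      a - b ≤ t * (M / 2 * B ^ 2 + 2 * L' ^ 2) := by
    intro t ht htB htL
    have hTm : Measurable fun x => x + t * h x := measurable_id.add (hm.const_mul t)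
    have hTK : ∀ x ∈ K, x + t * h x ∈ Set.Icc (-(r + 1)) (r + 1) := by
      intro x hx
      have h1 := abs_le.1 (hKr x hx)
      have h2 : |t * h x| ≤ 1 := by
        rw [abs_mul, abs_of_pos ht]
        exact (mul_le_mul_of_nonneg_left (hB x hx) ht.le).trans htB
      have h3 := abs_le.1 h2
      exact ⟨by linarith, by linarith⟩
    have hVT : Integrable (fun x => V (x + t * h x)) ν := by
      refine Integrable.of_bound (hcV.measurable.comp hTm).aestronglyMeasurable M₀ ?_
      filter_upwards [hK] with x hx using hM₀ _ (hTK x hx)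
    have htu : ∀ᵐ z ∂ν.prod ν, |t * u z| ≤ 1 / 2 := by
      filter_upwards [huL] with z hz
      rw [abs_mul, abs_of_pos ht]
      exact (mul_le_mul_of_nonneg_left hz ht.le).trans htL
    have hdiff : ∀ᵐ z ∂ν.prod ν, (z.1 + t * h z.1) - (z.2 + t * h z.2)
        = (z.1 - z.2) * (1 + t * u z) := by
      filter_upwards [ae_fst_ne_snd hf.2.1] with z c
      have : z.1 - z.2 ≠ 0 := sub_ne_zero.2 c
      simp only [hu]; field_simp; ring
    have hlogae : (fun z : ℝ × ℝ => Real.log |(z.1 + t * h z.1) - (z.2 + t * h z.2)|)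
        =ᵐ[ν.prod ν] fun z => Real.log |z.1 - z.2| + Real.log (1 + t * u z) := by
      filter_upwards [hdiff, htu, ae_fst_ne_snd hf.2.1] with z e1 e2 c
      have e3 := abs_le.1 e2
      rw [e1, abs_mul, Real.log_mul (abs_ne_zero.2 (sub_ne_zero.2 c))
        (abs_ne_zero.2 (by linarith)), Real.log_abs (1 + _)]
    have hlow : ∀ᵐ z ∂ν.prod ν, t * u z - 2 * t ^ 2 * L' ^ 2 ≤ Real.log (1 + t * u z) := by
      filter_upwards [htu, huL] with z e1 e2
      have e3 := sub_two_mul_sq_le_log_one_add e1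
      have e4 : u z ^ 2 ≤ L' ^ 2 := by rw [← sq_abs]; gcongr
      nlinarith [mul_le_mul_of_nonneg_left e4 (sq_nonneg t)]
    have hup : ∀ᵐ z ∂ν.prod ν, Real.log (1 + t * u z) ≤ t * u z := by
      filter_upwards [htu] with z e1
      have e3 := abs_le.1 e1
      have := Real.log_le_sub_one_of_pos (show 0 < 1 + t * u z by linarith)
      linarith
    have ilow : Integrable (fun z => t * u z - 2 * t ^ 2 * L' ^ 2) (ν.prod ν) :=
      (hui.const_mul t).sub (integrable_const _)
    have hli : Integrable (fun z => Real.log (1 + t * u z)) (ν.prod ν) :=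
      integrable_of_le_of_le (Real.measurable_log.comp
        ((hum.const_mul t).const_add 1)).aestronglyMeasurable hlow hup ilow (hui.const_mul t)
    have hfin : HasFiniteLogEnergy V (ν.map fun x => x + t * h x) := by
      refine hasFiniteLogEnergy_map hcV hTm hVT ?_ ((hf.2.2.add hli).congr hlogae.symm)
      filter_upwards [hdiff, htu, ae_fst_ne_snd hf.2.1] with z e1 e2 c
      have e3 := abs_le.1 e2
      rw [← sub_ne_zero, e1]
      exact mul_ne_zero (sub_ne_zero.2 c) (by linarith)
    have := Measure.isProbabilityMeasure_map (μ := ν) hTm.aemeasurable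
    have hmin := hν.finiteLogEnergy_le hf hfin
    rw [finiteLogEnergy_map hcV hTm, integral_congr_ae hlogae, integral_add hf.2.2 hli,
      finiteLogEnergy] at hmin
    have hI1 : ∫ x, V (x + t * h x) ∂ν ≤ (∫ x, V x ∂ν) + (t * b + t ^ 2 * (M / 2 * B ^ 2)) := by
      have i1 : Integrable (fun x => t * (deriv V x * h x) + t ^ 2 * (M / 2 * B ^ 2)) ν :=
        (hVh.const_mul t).add (integrable_const _)
      have e : (∫ x, V x ∂ν) + (t * b + t ^ 2 * (M / 2 * B ^ 2))
          = ∫ x, (V x + (t * (deriv V x * h x) + t ^ 2 * (M / 2 * B ^ 2))) ∂ν := by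
        rw [integral_add hf.1 i1, integral_add (hVh.const_mul t) (integrable_const _),
          integral_const_mul]
        simp [b]
      rw [e]
      refine integral_mono_ae hVT (hf.1.add i1) ?_
      filter_upwards [hK] with x hx
      have hx' := abs_le.1 (hKr x hx)
      have hxm : x ∈ Set.Icc (-(r + 1)) (r + 1) := ⟨by linarith, by linarith⟩
      have h1 := bregman_le_of_deriv_two_le hV (c := M) (x := x) (y := x + t * h x) fun z hz =>
        (le_abs_self _).trans (hM z (Set.uIcc_subset_Icc hxm (hTK x hx) hz))
      have hM0 : 0 ≤ M := (norm_nonneg _).trans (hM x hxm)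
      unfold bregman at h1
      have h2 : h x ^ 2 ≤ B ^ 2 := by
        rw [← sq_abs]; exact pow_le_pow_left₀ (abs_nonneg _) (hB x hx) 2
      have h3 := mul_le_mul_of_nonneg_left h2 (mul_nonneg (half_pos one_pos).le
        (mul_nonneg hM0 (sq_nonneg t)))
      linarith
    have hI2 : t * a - 2 * t ^ 2 * L' ^ 2 ≤ ∫ z, Real.log (1 + t * u z) ∂(ν.prod ν) := by
      have e : t * a - 2 * t ^ 2 * L' ^ 2 = ∫ z, (t * u z - 2 * t ^ 2 * L' ^ 2) ∂(ν.prod ν) := by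
        rw [integral_sub (hui.const_mul t) (integrable_const _), integral_const_mul]
        simp [a]
      rw [e]
      exact integral_mono_ae ilow hli hlow
    have : t * (a - b) ≤ t * (t * (M / 2 * B ^ 2 + 2 * L' ^ 2)) := by linarith
    exact le_of_mul_le_mul_left this ht
  have hlim : Tendsto (fun t : ℝ => t * (M / 2 * B ^ 2 + 2 * L' ^ 2)) (𝓝[>] 0) (𝓝 0) := by
    have : Continuous fun t : ℝ => t * (M / 2 * B ^ 2 + 2 * L' ^ 2) := by fun_prop
    simpa using (this.tendsto 0).mono_left nhdsWithin_le_nhds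
  have hev : ∀ C : ℝ, ∀ ε > 0, ∀ᶠ t : ℝ in 𝓝[>] 0, t * C ≤ ε := by
    intro C ε hε
    have hc : Continuous fun t : ℝ => t * C := by fun_prop
    have h1 : Tendsto (fun t : ℝ => t * C) (𝓝[>] 0) (𝓝 0) := by
      simpa using (hc.tendsto 0).mono_left nhdsWithin_le_nhds
    exact h1.eventually_le_const hε
  have := ge_of_tendsto hlim (b := a - b) (by
    filter_upwards [self_mem_nhdsWithin, hev B 1 one_pos, hev L' (1 / 2) (by norm_num)] with t h1 h2 h3
    exact main t h1 h2 h3)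
  linarith

end FirstVariation

/-! ### The curvature of the field is seen by the equilibrium measure -/

section Curvature

open Filter Topology

/-- The test function `α / (w - x) ^ 2` to the left of `w` and `-β / (w - x) ^ 2` to the right. -/
noncomputable def gapTest (w α β x : ℝ) : ℝ :=
  if x < w then α * (1 / (w - x)) ^ 2 else -(β * (1 / (w - x)) ^ 2)

/-- For h = c / (w - x)² the difference quotient equals h(x) / (w - y) + h(y) / (w - x) identically.
This gives equality when both points lie on the same side of w. Across w the opposite signs add an
error proportional to α + β, which is strictly positive. -/
theorem gapTest_quotient_ge {w α β x y : ℝ} (hα : 0 < α) (hβ : 0 < β) (hx : x ≠ w) (hy : y ≠ w)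
    (hxy : x ≠ y) :
    gapTest w α β x * (1 / (w - y)) + gapTest w α β y * (1 / (w - x))
      ≤ (gapTest w α β x - gapTest w α β y) / (x - y) ∧
    (x < w → w < y → gapTest w α β x * (1 / (w - y)) + gapTest w α β y * (1 / (w - x))
      < (gapTest w α β x - gapTest w α β y) / (x - y)) := by
  have hx0 : w - x ≠ 0 := sub_ne_zero.2 hx.symm
  have hy0 : w - y ≠ 0 := sub_ne_zero.2 hy.symm
  have hxy0 : x - y ≠ 0 := sub_ne_zero.2 hxy
  have same : ∀ c : ℝ, c * (1 / (w - x)) ^ 2 * (1 / (w - y)) + c * (1 / (w - y)) ^ 2 * (1 / (w - x))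
      = (c * (1 / (w - x)) ^ 2 - c * (1 / (w - y)) ^ 2) / (x - y) := by
    intro c; field_simp; ring
  have opp : ∀ c d : ℝ, (c * (1 / (w - x)) ^ 2 - -(d * (1 / (w - y)) ^ 2)) / (x - y)
      - (c * (1 / (w - x)) ^ 2 * (1 / (w - y)) + -(d * (1 / (w - y)) ^ 2) * (1 / (w - x)))
      = (c + d) / ((y - x) * (-((w - x) * (w - y)))) := by
    intro c d
    have : y - x ≠ 0 := by intro h; apply hxy0; linarith
    field_simp; ring
  unfold gapTest
  rcases lt_or_gt_of_ne hx with h1 | h1 <;> rcases lt_or_gt_of_ne hy with h2 | h2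
  · simp only [if_pos h1, if_pos h2]
    exact ⟨(same α).le, fun _ h => absurd h (not_lt.2 h2.le)⟩
  · simp only [if_pos h1, if_neg (not_lt.2 h2.le)]
    have h3 : 0 < (α + β) / ((y - x) * (-((w - x) * (w - y)))) := by
      refine div_pos (by linarith) (mul_pos (by linarith) ?_)
      nlinarith [mul_pos (sub_pos.2 h1) (sub_pos.2 h2)]
    have h4 := opp α β
    exact ⟨by linarith, fun _ _ => by linarith⟩
  · simp only [if_neg (not_lt.2 h1.le), if_pos h2]
    refine ⟨?_, fun h => absurd h (not_lt.2 h1.le)⟩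
    have h3 : 0 < (-β + -α) / ((y - x) * (-((w - x) * (w - y)))) := by
      refine div_pos_of_neg_of_neg (by linarith) (mul_neg_of_neg_of_pos (by linarith) ?_)
      nlinarith [mul_pos (sub_pos.2 h1) (sub_pos.2 h2)]
    have h4 := opp (-β) (-α)
    simp only [neg_mul, neg_neg] at h4 ⊢
    linarith
  · simp only [if_neg (not_lt.2 h1.le), if_neg (not_lt.2 h2.le)]
    refine ⟨?_, fun h => absurd h (not_lt.2 h1.le)⟩
    have := same (-β)
    simp only [neg_mul] at this ⊢
    exact this.le

theorem measurable_gapTest (w α β : ℝ) : Measurable (gapTest w α β) := by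
  unfold gapTest
  refine Measurable.ite measurableSet_Iio ?_ ?_ <;> fun_prop

theorem abs_gapTest_le {w α β η x : ℝ} (hα : 0 < α) (hβ : 0 < β) (hη : 0 < η) (hx : η ≤ |w - x|) :
    |gapTest w α β x| ≤ (α + β) * (1 / η) ^ 2 := by
  have h1 : (1 / (w - x)) ^ 2 ≤ (1 / η) ^ 2 := by
    rw [← sq_abs (1 / (w - x)), abs_div, abs_one]
    gcongr
  have h0 : 0 ≤ (1 / (w - x)) ^ 2 := sq_nonneg _
  unfold gapTest
  split_ifs
  · rw [abs_of_nonneg (by positivity)]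
    exact mul_le_mul (by linarith) h1 h0 (by linarith)
  · rw [abs_neg, abs_of_nonneg (by positivity)]
    exact mul_le_mul (by linarith) h1 h0 (by linarith)

theorem abs_gapTest_sub_le {w α β η x y : ℝ} (hα : 0 < α) (hβ : 0 < β) (hη : 0 < η)
    (hx : η ≤ |w - x|) (hy : η ≤ |w - y|) :
    |gapTest w α β x - gapTest w α β y| ≤ 2 * (α + β) * (1 / η) ^ 3 * |x - y| := by
  have hη' : 0 < 1 / η := by positivity
  have hx0 : w - x ≠ 0 := by rw [← abs_pos]; linarith
  have hy0 : w - y ≠ 0 := by rw [← abs_pos]; linarith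
  have ux : |1 / (w - x)| ≤ 1 / η := by rw [abs_div, abs_one]; gcongr
  have uy : |1 / (w - y)| ≤ 1 / η := by rw [abs_div, abs_one]; gcongr
  have same : ∀ c : ℝ, |c| ≤ α + β →
      |c * (1 / (w - x)) ^ 2 - c * (1 / (w - y)) ^ 2| ≤ 2 * (α + β) * (1 / η) ^ 3 * |x - y| := by
    intro c hc
    have e : c * (1 / (w - x)) ^ 2 - c * (1 / (w - y)) ^ 2
        = c * ((1 / (w - x)) * (1 / (w - y))) * (1 / (w - x) + 1 / (w - y)) * (x - y) := by
      field_simp; ring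
    rw [e, abs_mul, abs_mul, abs_mul, abs_mul]
    refine mul_le_mul_of_nonneg_right ?_ (abs_nonneg _)
    have h1 : |1 / (w - x) + 1 / (w - y)| ≤ 1 / η + 1 / η := (abs_add_le _ _).trans (add_le_add ux uy)
    calc _ ≤ (α + β) * ((1 / η) * (1 / η)) * (1 / η + 1 / η) := by gcongr
      _ = _ := by ring
  have opp : η + η ≤ |x - y| → |gapTest w α β x - gapTest w α β y|
      ≤ 2 * (α + β) * (1 / η) ^ 3 * |x - y| := by
    intro hd
    have h1 := abs_gapTest_le hα hβ hη hx
    have h2 := abs_gapTest_le hα hβ hη hy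
    refine (abs_sub _ _).trans ?_
    have e : 2 * (α + β) * (1 / η) ^ 3 * η = 2 * ((α + β) * (1 / η) ^ 2) := by field_simp
    have h3 : 2 * (α + β) * (1 / η) ^ 3 * η ≤ 2 * (α + β) * (1 / η) ^ 3 * |x - y| := by
      gcongr; linarith
    linarith
  rcases lt_or_ge x w with h1 | h1 <;> rcases lt_or_ge y w with h2 | h2
  · simp only [gapTest, if_pos h1, if_pos h2]
    exact same α (by rw [abs_of_pos hα]; linarith)
  · apply opp
    rw [abs_of_pos (by linarith)] at hx
    rw [abs_of_nonpos (by linarith)] at hy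
    rw [abs_of_neg (by linarith)]; linarith
  · apply opp
    rw [abs_of_pos (by linarith)] at hy
    rw [abs_of_nonpos (by linarith)] at hx
    rw [abs_of_nonneg (by linarith)]; linarith
  · simp only [gapTest, if_neg (not_lt.2 h1), if_neg (not_lt.2 h2)]
    have := same (-β) (by rw [abs_neg, abs_of_pos hβ]; linarith)
    simpa only [neg_mul] using this

/-- A compactly supported equilibrium measure in a convex field has no gap in its support. -/
theorem mem_support_of_convexOn {V : ℝ → ℝ} (hV : ContDiff ℝ 2 V) (hc : ConvexOn ℝ Set.univ V)
    {ν : Measure ℝ} (hν : IsEquilibriumMeasure V ν) {r : ℝ} (hr : ∀ x ∈ ν.support, |x| ≤ r)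
    {x w y : ℝ} (hx : x ∈ ν.support) (hy : y ∈ ν.support) (hxw : x < w) (hwy : w < y) :
    w ∈ ν.support := by
  by_contra hw
  have := hν.1
  have hf := hν.hasFiniteLogEnergy hV.continuous
  have hS : ∀ᵐ x ∂ν, x ∈ ν.support := Measure.support_mem_ae
  obtain ⟨η, hη, hball⟩ := Metric.isOpen_iff.1 Measure.isOpen_compl_support w hw
  have hdist : ∀ x ∈ ν.support, η ≤ |w - x| := by
    intro x hx
    by_contra! hlt
    exact hball (by rw [Metric.mem_ball, Real.dist_eq, abs_sub_comm]; exact hlt) hx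
  have hu2 : ∀ x ∈ ν.support, (1 / (w - x)) ^ 2 ≤ (1 / η) ^ 2 := by
    intro x hx
    rw [← sq_abs (1 / (w - x)), abs_div, abs_one]
    have := hdist x hx
    gcongr
  have hum : Measurable fun x : ℝ => 1 / (w - x) := by fun_prop
  have hui : Integrable (fun x : ℝ => 1 / (w - x)) ν := by
    refine Integrable.of_bound hum.aestronglyMeasurable (1 / η) ?_
    filter_upwards [hS] with x hx
    rw [Real.norm_eq_abs, abs_div, abs_one]
    have := hdist x hx
    gcongr
  have hu2i : Integrable (fun x : ℝ => (1 / (w - x)) ^ 2) ν := by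
    refine Integrable.of_bound (hum.pow_const 2).aestronglyMeasurable ((1 / η) ^ 2) ?_
    filter_upwards [hS] with x hx
    rw [Real.norm_eq_abs, abs_of_nonneg (sq_nonneg _)]
    exact hu2 x hx
  have posL : 0 < ν (Set.Iio w) := (Measure.mem_support_iff_forall x).1 hx _ (Iio_mem_nhds hxw)
  have posR : 0 < ν (Set.Ioi w) := (Measure.mem_support_iff_forall y).1 hy _ (Ioi_mem_nhds hwy)
  have hpos : ∀ s : Set ℝ, MeasurableSet s → w ∉ s → 0 < ν s →
      0 < ∫ x in s, (1 / (w - x)) ^ 2 ∂ν := by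
    intro s hs hws h0
    rw [setIntegral_pos_iff_support_of_nonneg_ae (Eventually.of_forall fun x => sq_nonneg _)
      hu2i.integrableOn]
    refine h0.trans_le (measure_mono fun x hx => ⟨?_, hx⟩)
    have : w - x ≠ 0 := by rw [sub_ne_zero]; rintro rfl; exact hws hx
    simpa using this
  -- The weights are crossed, each being the integral over the opposite side, so that the test
  -- function h has zero integral.
  set α := ∫ x in Set.Ioi w, (1 / (w - x)) ^ 2 ∂ν
  set β := ∫ x in Set.Iio w, (1 / (w - x)) ^ 2 ∂ν
  have hα : 0 < α := hpos _ measurableSet_Ioi (by simp) posR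
  have hβ : 0 < β := hpos _ measurableSet_Iio (by simp) posL
  set h := gapTest w α β with hh
  have hhm : Measurable h := measurable_gapTest w α β
  have hhi : Integrable h ν := by
    refine Integrable.of_bound hhm.aestronglyMeasurable ((α + β) * (1 / η) ^ 2) ?_
    filter_upwards [hS] with x hx using abs_gapTest_le hα hβ hη (hdist x hx)
  have hh0 : ∫ x, h x ∂ν = 0 := by
    have e : h =ᵐ[ν] fun x => α * (Set.Iio w).indicator (fun x => (1 / (w - x)) ^ 2) x
        - β * (Set.Ioi w).indicator (fun x => (1 / (w - x)) ^ 2) x := by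
      filter_upwards [hS] with x hx
      have hne : x ≠ w := by rintro rfl; exact hw hx
      rcases lt_or_gt_of_ne hne with h1 | h1
      · simp [hh, gapTest, h1, h1.le]
      · simp [hh, gapTest, h1, not_lt.2 h1.le]
    rw [integral_congr_ae e, integral_sub ((hu2i.indicator measurableSet_Iio).const_mul α)
      ((hu2i.indicator measurableSet_Ioi).const_mul β), integral_const_mul, integral_const_mul,
      integral_indicator measurableSet_Iio, integral_indicator measurableSet_Ioi]
    simp only [α, β]; ring
  obtain ⟨hki, hVi, hle⟩ := integral_quotient_le_integral_deriv_mul hV hν hS hr hhm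
    (fun x hx => abs_gapTest_le hα hβ hη (hdist x hx))
    (fun x hx y hy => abs_gapTest_sub_le hα hβ hη (hdist x hx) (hdist y hy))
  -- V' is monotone while h is positive left of w and nonpositive to the right, so V' may be
  -- replaced by the constant V'(w), and h has mean zero.
  have hVle : ∫ x, deriv V x * h x ∂ν ≤ 0 := by
    have hmono := hc.monotone_deriv_of_differentiable (hV.differentiable two_ne_zero)
    calc _ ≤ ∫ x, deriv V w * h x ∂ν := by
          refine integral_mono hVi (hhi.const_mul _) fun x => ?_
          simp only [hh, gapTest]
          split_ifs with hxw
          · exact mul_le_mul_of_nonneg_right (hmono hxw.le) (by positivity)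
          · exact mul_le_mul_of_nonpos_right (hmono (not_lt.1 hxw)) (by simp; positivity)
      _ = 0 := by rw [integral_const_mul, hh0, mul_zero]
  set g : ℝ × ℝ → ℝ := fun z => h z.1 * (1 / (w - z.2)) + h z.2 * (1 / (w - z.1)) with hg
  have ig1 : Integrable (fun z : ℝ × ℝ => h z.1 * (1 / (w - z.2))) (ν.prod ν) := hhi.mul_prod hui
  have ig2 : Integrable (fun z : ℝ × ℝ => h z.2 * (1 / (w - z.1))) (ν.prod ν) := by
    simpa only [mul_comm] using hui.mul_prod hhi
  have igi : Integrable g (ν.prod ν) := ig1.add ig2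
  -- Both terms factor through the vanishing integral of h. With the first variation this forces
  -- equality almost everywhere in the pointwise bound, which is strict across w; hence one of the
  -- two sides has measure zero.
  have hg0 : ∫ z, g z ∂(ν.prod ν) = 0 := by
    have e1 : ∫ z : ℝ × ℝ, h z.1 * (1 / (w - z.2)) ∂(ν.prod ν) = 0 := by
      rw [integral_prod_mul h (fun y => 1 / (w - y)), hh0, zero_mul]
    have e2 : ∫ z : ℝ × ℝ, h z.2 * (1 / (w - z.1)) ∂(ν.prod ν) = 0 := by
      simp only [mul_comm (h _)]
      rw [integral_prod_mul (fun y => 1 / (w - y)) h, hh0, mul_zero]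
    rw [hg, integral_add ig1 ig2, e1, e2, add_zero]
  have h1 : ∀ᵐ z ∂ν.prod ν, z.1 ∈ ν.support := Measure.quasiMeasurePreserving_fst.ae hS
  have h2 : ∀ᵐ z ∂ν.prod ν, z.2 ∈ ν.support := Measure.quasiMeasurePreserving_snd.ae hS
  have hpt : ∀ᵐ z ∂ν.prod ν, g z ≤ (h z.1 - h z.2) / (z.1 - z.2) ∧
      (z.1 < w → w < z.2 → g z < (h z.1 - h z.2) / (z.1 - z.2)) := by
    filter_upwards [h1, h2, ae_fst_ne_snd hf.2.1] with z a b c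
    exact gapTest_quotient_ge hα hβ (by intro e; exact hw (e ▸ a)) (by intro e; exact hw (e ▸ b)) c
  have hnn : 0 ≤ᵐ[ν.prod ν] fun z => (h z.1 - h z.2) / (z.1 - z.2) - g z := by
    filter_upwards [hpt] with z hz using sub_nonneg.2 hz.1
  have hint0 : ∫ z, ((h z.1 - h z.2) / (z.1 - z.2) - g z) ∂(ν.prod ν) = 0 := by
    refine le_antisymm ?_ (integral_nonneg_of_ae hnn)
    rw [integral_sub hki igi, hg0]
    linarith
  have hz := (integral_eq_zero_iff_of_nonneg_ae hnn (hki.sub igi)).1 hint0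
  have hnull : (ν.prod ν) (Set.Iio w ×ˢ Set.Ioi w) = 0 := by
    have : ∀ᵐ z ∂ν.prod ν, ¬ (z ∈ Set.Iio w ×ˢ Set.Ioi w) := by
      filter_upwards [hz, hpt] with z e1 e2 hmem
      have := e2.2 hmem.1 hmem.2
      simp only [Pi.zero_apply] at e1
      linarith
    rw [ae_iff] at this
    simpa only [not_not, Set.ofPred_mem_eq] using this
  rw [Measure.prod_prod] at hnull
  exact (ENNReal.mul_pos posL.ne' posR.ne').ne' hnull

theorem measure_deriv_two_pos {V : ℝ → ℝ} (hV : ContDiff ℝ 2 V) (hc : ConvexOn ℝ Set.univ V)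
    {ν : Measure ℝ} (hν : IsEquilibriumMeasure V ν) {r : ℝ}
    (hr : ∀ x, r ≤ |x| → 0 < deriv (deriv V) x) :
    ∃ x ∈ ν.support, 0 < deriv (deriv V) x := by
  by_contra! hcon
  have := hν.1
  have hf := hν.hasFiniteLogEnergy hV.continuous
  have hS : ∀ᵐ x ∂ν, x ∈ ν.support := Measure.support_mem_ae
  have hsr : ∀ x ∈ ν.support, |x| ≤ r := by
    intro x hx
    by_contra! hlt
    exact absurd (hr x hlt.le) (not_lt.2 (hcon x hx))
  have hdd := hV.hasDerivAt_deriv_two.1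
  have hmono := hc.monotone_deriv_of_differentiable (hV.differentiable two_ne_zero)
  have hconst : ∀ x ∈ ν.support, ∀ y ∈ ν.support, x < y → deriv V x = deriv V y := by
    intro x hx y hy hxy
    refine le_antisymm (hmono hxy.le) ?_
    obtain ⟨w, hw, hslope⟩ := exists_deriv_eq_slope (deriv V) hxy hdd.continuous.continuousOn
      hdd.differentiableOn
    -- The mean value point lies between two points of the support, hence in it, so V'' ≤ 0 there
    -- and V' cannot increase from x to y.
    have h1 := hcon w (mem_support_of_convexOn hV hc hν hsr hx hy hw.1 hw.2)
    rw [hslope, div_nonpos_iff] at h1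
    rcases h1 with h1 | h1 <;> linarith [h1.1, h1.2]
  obtain ⟨x₀, hx₀⟩ := hS.exists
  have hconst' : ∀ x ∈ ν.support, deriv V x = deriv V x₀ := by
    intro x hx
    rcases lt_trichotomy x x₀ with h | rfl | h
    · exact hconst x hx x₀ hx₀ h
    · rfl
    · exact (hconst x₀ hx₀ x hx h).symm
  have hid : Measurable fun x : ℝ => x := measurable_id
  have hi : Integrable (fun x : ℝ => x) ν := Integrable.of_bound hid.aestronglyMeasurable r
    (by filter_upwards [hS] with x hx using hsr x hx)
  set c := ∫ x, x ∂ν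
  -- Dilation about the mean: the difference quotient is 1, while the integral against the constant
  -- V' vanishes, so the first variation reads 1 ≤ 0.
  have hfv := (integral_quotient_le_integral_deriv_mul hV hν hS hsr (h := fun x => x - c)
    (hid.sub_const c) (B := r + |c|) (L := 1)
    (fun x hx => (abs_sub _ _).trans (add_le_add_left (hsr x hx) _))
    (fun x _ y _ => by simp)).2.2
  have e1 : ∫ z : ℝ × ℝ, ((z.1 - c) - (z.2 - c)) / (z.1 - z.2) ∂(ν.prod ν) = 1 := by
    have : (fun z : ℝ × ℝ => ((z.1 - c) - (z.2 - c)) / (z.1 - z.2)) =ᵐ[ν.prod ν] fun _ => 1 := by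
      filter_upwards [ae_fst_ne_snd hf.2.1] with z hz
      rw [sub_sub_sub_cancel_right, div_self (sub_ne_zero.2 hz)]
    rw [integral_congr_ae this]; simp
  have e2 : ∫ x, deriv V x * (x - c) ∂ν = 0 := by
    have : (fun x => deriv V x * (x - c)) =ᵐ[ν] fun x => deriv V x₀ * (x - c) := by
      filter_upwards [hS] with x hx
      rw [hconst' x hx]
    rw [integral_congr_ae this, integral_const_mul, integral_sub hi (integrable_const c)]
    simp [c]
  rw [e1, e2] at hfv
  linarith

end Curvature

/-! ### Convex fields which are uniformly convex at infinity -/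

section UniformlyConvexAtInfinity

/-- A segment of length at least 4r has its first or last quarter outside (-r, r), and passing to
that quarter costs the factor 16 in ρ / 32. If instead |x| ≥ 5r and the segment is shorter, all of
it lies outside. -/
theorem mul_sq_le_bregman_of_far {V : ℝ → ℝ} (hV : ContDiff ℝ 2 V) (hc : ConvexOn ℝ Set.univ V)
    {r ρ : ℝ} (hρ : 0 < ρ) (h2 : ∀ x, r ≤ |x| → ρ ≤ deriv (deriv V) x)
    {x y : ℝ} (h : 4 * r ≤ |y - x| ∨ 5 * r ≤ |x|) : ρ / 32 * (y - x) ^ 2 ≤ bregman V x y := by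
  have hd : Differentiable ℝ V := hV.differentiable two_ne_zero
  have hseg : ∀ x' y', (∀ z ∈ Set.uIcc x' y', r ≤ |z|) → ρ / 2 * (y' - x') ^ 2 ≤ bregman V x' y' :=
    fun x' y' hz => le_bregman_of_le_deriv_two hV fun z hz' => h2 z (hz z hz')
  have hfar : 4 * r ≤ |y - x| → ρ / 32 * (y - x) ^ 2 ≤ bregman V x y := by
    intro hM
    rcases le_total x y with hxy | hxy
    · rw [abs_of_nonneg (by linarith)] at hM
      rcases le_total (r + (y - x) / 4) y with h3 | h3
      · refine le_trans (le_of_eq ?_) ((hseg (y - (y - x) / 4) y ?_).trans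
          (bregman_le_bregman hd hc (Or.inl ⟨by linarith, by linarith, le_rfl⟩)))
        · ring
        · intro z hz
          rw [Set.uIcc_of_le (by linarith)] at hz
          exact le_trans (by linarith [hz.1]) (le_abs_self z)
      · refine le_trans (le_of_eq ?_) ((hseg x (x + (y - x) / 4) ?_).trans
          (bregman_le_bregman hd hc (Or.inl ⟨le_rfl, by linarith, by linarith⟩)))
        · ring
        · intro z hz
          rw [Set.uIcc_of_le (by linarith)] at hz
          exact le_trans (by linarith [hz.2]) (neg_le_abs z)
    · rw [abs_of_nonpos (by linarith)] at hM
      rcases le_total (r + (x - y) / 4) x with h3 | h3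
      · refine le_trans (le_of_eq ?_) ((hseg x (x + (y - x) / 4) ?_).trans
          (bregman_le_bregman hd hc (Or.inr ⟨by linarith, by linarith, le_rfl⟩)))
        · ring
        · intro z hz
          rw [Set.uIcc_of_ge (by linarith)] at hz
          exact le_trans (by linarith [hz.1]) (le_abs_self z)
      · refine le_trans (le_of_eq ?_) ((hseg (y - (y - x) / 4) y ?_).trans
          (bregman_le_bregman hd hc (Or.inr ⟨le_rfl, by linarith, by linarith⟩)))
        · ring
        · intro z hz
          rw [Set.uIcc_of_ge (by linarith)] at hz
          exact le_trans (by linarith [hz.2]) (neg_le_abs z)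
  rcases le_or_gt (4 * r) |y - x| with hM | hM
  · exact hfar hM
  · have hR := h.resolve_left (not_le.2 hM)
    refine le_trans ?_ (hseg x y fun z hz => ?_)
    · nlinarith [mul_nonneg hρ.le (sq_nonneg (y - x))]
    · have h3 : |x - z| ≤ |y - x| := by
        rw [abs_sub_comm x z]
        exact Set.abs_sub_left_of_mem_uIcc hz
      have h4 := abs_sub_abs_le_abs_sub x z
      linarith

/-- Curvature is known only within δ of x. A longer displacement is cut at length δ, where the
divergence is already at least εδ² / 2; truncating the right quantity at M makes this sufficient. -/
theorem mul_min_sq_le_bregman {V : ℝ → ℝ} (hV : ContDiff ℝ 2 V) (hc : ConvexOn ℝ Set.univ V)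
    {ε δ M x y : ℝ} (hε : 0 < ε) (hδ : 0 < δ) (hδM : δ ≤ M)
    (h2 : ∀ z, |z - x| ≤ δ → ε ≤ deriv (deriv V) z) :
    ε * δ ^ 2 / (2 * M ^ 2) * (min |y - x| M) ^ 2 ≤ bregman V x y := by
  have hd : Differentiable ℝ V := hV.differentiable two_ne_zero
  have hM : 0 < M := hδ.trans_le hδM
  have hseg : ∀ y', |y' - x| ≤ δ → ε / 2 * (y' - x) ^ 2 ≤ bregman V x y' := fun y' hy' =>
    le_bregman_of_le_deriv_two hV fun z hz => h2 z ((Set.abs_sub_left_of_mem_uIcc hz).trans hy')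
  have hδM2 : δ ^ 2 ≤ M ^ 2 := pow_le_pow_left₀ hδ.le hδM 2
  have hmin0 : 0 ≤ min |y - x| M := le_min (abs_nonneg _) hM.le
  rcases le_total |y - x| δ with h | h
  · refine le_trans ?_ (hseg y h)
    have h1 : (min |y - x| M) ^ 2 ≤ (y - x) ^ 2 := by
      rw [← sq_abs (y - x)]; exact pow_le_pow_left₀ hmin0 (min_le_left _ _) 2
    have h3 : ε * δ ^ 2 / (2 * M ^ 2) ≤ ε / 2 := by
      rw [div_le_div_iff₀ (by positivity) (by norm_num)]
      nlinarith
    exact mul_le_mul h3 h1 (sq_nonneg _) (by positivity)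
  · have h1 : (min |y - x| M) ^ 2 ≤ M ^ 2 := pow_le_pow_left₀ hmin0 (min_le_right _ _) 2
    have h3 : ε * δ ^ 2 / (2 * M ^ 2) * (min |y - x| M) ^ 2 ≤ ε / 2 * δ ^ 2 := by
      calc _ ≤ ε * δ ^ 2 / (2 * M ^ 2) * M ^ 2 := by gcongr
        _ = _ := by field_simp
    refine h3.trans ?_
    rcases le_total x y with hxy | hxy
    · rw [abs_of_nonneg (by linarith)] at h
      have := hseg (x + δ) (by simp [abs_of_pos hδ])
      simp only [add_sub_cancel_left] at this
      exact this.trans (bregman_le_bregman hd hc (Or.inl ⟨le_rfl, by linarith, by linarith⟩))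
    · rw [abs_of_nonpos (by linarith)] at h
      have := hseg (x - δ) (by simp [abs_of_pos hδ])
      simp only [sub_sub_cancel_left, neg_sq] at this
      exact this.trans (bregman_le_bregman hd hc (Or.inr ⟨by linarith, by linarith, le_rfl⟩))

theorem exists_lower_bound_of_deriv_two {V : ℝ → ℝ} (hV : ContDiff ℝ 2 V)
    (hc : ConvexOn ℝ Set.univ V) {r ρ : ℝ} (hρ : 0 < ρ)
    (h2 : ∀ x, r ≤ |x| → ρ ≤ deriv (deriv V) x) : ∃ m, ∀ x, m ≤ V x := by
  refine bddBelow_of_quadratic (a := V 0 - ρ / 32 * (4 * r) ^ 2) (b := deriv V 0) (c := ρ / 32)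
    (by positivity) fun y => ?_
  have h0 := bregman_nonneg (hV.differentiable two_ne_zero) hc 0 y
  have h1 := fun h => mul_sq_le_bregman_of_far hV hc hρ h2 (x := 0) (y := y) (Or.inl h)
  unfold bregman at h0 h1
  simp only [sub_zero] at h0 h1
  rcases le_total (4 * r) |y| with h | h
  · have := h1 h
    nlinarith [mul_nonneg hρ.le (sq_nonneg (4 * r))]
  · have : y ^ 2 ≤ (4 * r) ^ 2 := by
      rw [← sq_abs]; exact pow_le_pow_left₀ (abs_nonneg _) h 2
    nlinarith [mul_le_mul_of_nonneg_left this hρ.le]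

theorem sq_le_of_far_of_near {x y h₁ h₂ ρ c R M D₁ D₂ φ : ℝ} (hρ : 0 < ρ) (hc : 0 < c) (hM : 0 < M)
    (hMR : M ≤ R) (hD₁ : 0 ≤ D₁) (hD₂ : 0 ≤ D₂) (hxy : x ≠ y)
    (hq : 0 < ((x + h₁) - (y + h₂)) / (x - y))
    (hφ : φ = ((x + h₁) - (y + h₂)) / (x - y) - 1 - Real.log (((x + h₁) - (y + h₂)) / (x - y)))
    (hy : |y| ≤ R) (h1 : M ≤ |h₁| ∨ R ≤ |x| → ρ / 32 * h₁ ^ 2 ≤ D₁)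
    (h2 : c * (min |h₂| M) ^ 2 ≤ D₂) :
    h₁ ^ 2 ≤ (32 / ρ + 4 / c + 144 * R ^ 2) * (D₁ + φ + D₂) := by
  have hφ0 : 0 ≤ φ := by rw [hφ]; linarith [Real.log_le_sub_one_of_pos hq]
  have hA : h₁ ^ 2 ≤ 32 / ρ * D₁ ∨ h₁ ^ 2 ≤ 4 / c * D₂ ∨ h₁ ^ 2 ≤ 144 * R ^ 2 * φ := by
    by_cases hfar : M ≤ |h₁| ∨ R ≤ |x|
    -- Here the displacement at x is at most twice the truncated one at y, so D₂ pays for it.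
    · left
      have := h1 hfar
      rw [div_mul_eq_mul_div, le_div_iff₀ hρ]
      linarith
    · right
      push Not at hfar
      obtain ⟨hM1, hxR⟩ := hfar
      rcases le_or_gt |h₁| (2 * min |h₂| M) with hk | hk
      · left
        have : h₁ ^ 2 ≤ (2 * min |h₂| M) ^ 2 := by
          rw [← sq_abs]; exact pow_le_pow_left₀ (abs_nonneg _) hk 2
        rw [div_mul_eq_mul_div, le_div_iff₀ hc]
        nlinarith
      · right
        -- The displacements differ by at least half of h₁. As |x - y| ≤ 2R, the quotient is at
        -- least |h₁| / (4R) away from 1, and the logarithmic bound gives 144 = 9 · 16.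
        have hk2 : |h₁| / 2 ≤ |h₁ - h₂| := by
          rcases le_total |h₂| M with h | h
          · rw [min_eq_left h] at hk
            linarith [abs_sub_abs_le_abs_sub h₁ h₂]
          · rw [min_eq_right h] at hk
            linarith
        have hd : 0 < |x - y| := abs_pos.2 (sub_ne_zero.2 hxy)
        have hdR : |x - y| ≤ 2 * R := (abs_sub _ _).trans (by linarith)
        have hR : 0 < R := hM.trans_le hMR
        have hq1 : |((x + h₁) - (y + h₂)) / (x - y) - 1| = |h₁ - h₂| / |x - y| := by
          rw [← abs_div]; congr 1
          have := sub_ne_zero.2 hxy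
          field_simp; ring
        have hv : |h₁| / (4 * R) ≤ |((x + h₁) - (y + h₂)) / (x - y) - 1| := by
          rw [hq1, div_le_div_iff₀ (by positivity) hd]
          have := mul_le_mul hk2 hdR hd.le (abs_nonneg _)
          linarith
        have := sq_div_nine_le_sub_one_sub_log hq (by positivity)
          (by rw [div_le_one (by positivity)]; linarith) hv
        rw [← hφ, div_pow, sq_abs] at this
        have e : h₁ ^ 2 = 144 * R ^ 2 * (h₁ ^ 2 / (4 * R) ^ 2 / 9) := by
          field_simp; ring
        rw [e]
        gcongr
  have e1 : 0 ≤ 32 / ρ := by positivity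
  have e2 : 0 ≤ 4 / c := by positivity
  have e3 : 0 ≤ 144 * R ^ 2 := by positivity
  have := mul_nonneg e1 hφ0
  have := mul_nonneg e1 hD₂
  have := mul_nonneg e1 hD₁
  have := mul_nonneg e2 hφ0
  have := mul_nonneg e2 hD₂
  have := mul_nonneg e2 hD₁
  have := mul_nonneg e3 hφ0
  have := mul_nonneg e3 hD₂
  have := mul_nonneg e3 hD₁
  rcases hA with h | h | h <;> linarith

theorem exists_pos_mul_wassersteinDist_two_le_sub {V : ℝ → ℝ} (hV : ContDiff ℝ 2 V)
    (hc : ConvexOn ℝ Set.univ V) {ν : Measure ℝ} (hν : IsEquilibriumMeasure V ν) {r ρ : ℝ}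
    (hρ : 0 < ρ) (h2 : ∀ x, r ≤ |x| → ρ ≤ deriv (deriv V) x) :
    ∃ C : ℝ, 0 < C ∧ ∀ μ : Measure ℝ, IsProbabilityMeasure μ →
      ((ENNReal.ofReal C * wassersteinDist 2 μ ν ^ (2 : ℝ) : ℝ≥0∞) : EReal)
        ≤ logEnergy V μ - logEnergy V ν := by
  have hd : Differentiable ℝ V := hV.differentiable two_ne_zero
  have := hν.1
  have hf := hν.hasFiniteLogEnergy hd.continuous
  obtain ⟨x₀, hx₀, hpos⟩ := measure_deriv_two_pos hV hc hν fun x hx => hρ.trans_le (h2 x hx)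
  -- The hypothesis allows any real r; enlarging it makes M positive and at least δ.
  set r' := max r 1 with hr'
  have hr1 : 1 ≤ r' := le_max_right _ _
  have h2' : ∀ x, r' ≤ |x| → ρ ≤ deriv (deriv V) x := fun x hx => h2 x ((le_max_left _ _).trans hx)
  set ε := deriv (deriv V) x₀ / 2 with hε
  have hε0 : 0 < ε := by positivity
  obtain ⟨δ₀, hδ₀, hball⟩ := Metric.continuous_iff.1 hV.hasDerivAt_deriv_two.2 x₀ ε hε0
  -- A point within δ of the ball S is within 2δ < δ₀ of x₀, so V'' stays above half of V''(x₀).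
  set δ := min (δ₀ / 3) 1 with hδ
  have hδ0 : 0 < δ := by positivity
  have hδ1 : δ ≤ 1 := min_le_right _ _
  have hδ3 : δ ≤ δ₀ / 3 := min_le_left _ _
  have hnear : ∀ x ∈ Metric.ball x₀ δ, ∀ z, |z - x| ≤ δ → ε ≤ deriv (deriv V) z := by
    intro x hx z hz
    rw [Metric.mem_ball, Real.dist_eq] at hx
    have h1 : |z - x₀| ≤ |z - x| + |x - x₀| := abs_sub_le _ _ _
    have h3 := hball z (by rw [Real.dist_eq]; linarith)
    rw [Real.dist_eq] at h3
    have := (abs_lt.1 h3).1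
    linarith
  set S := Metric.ball x₀ δ
  have hSpos : 0 < ν S := (Measure.mem_support_iff_forall x₀).1 hx₀ _ (Metric.ball_mem_nhds _ hδ0)
  set M := 4 * r' with hM
  set R := 5 * r' + |x₀| + 1 with hR
  have hM0 : 0 < M := by positivity
  have hMR : M ≤ R := by rw [hM, hR]; linarith [abs_nonneg x₀]
  set c := ε * δ ^ 2 / (2 * M ^ 2) with hcdef
  have hc0 : 0 < c := by positivity
  set A := 32 / ρ + 4 / c + 144 * R ^ 2
  have hA0 : 0 < A := by positivity
  have hSR : ∀ y ∈ S, |y| ≤ R := by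
    intro y hy
    rw [Metric.mem_ball, Real.dist_eq] at hy
    have := abs_sub_abs_le_abs_sub y x₀
    rw [hR]; linarith
  refine ⟨(ν S).toReal / (2 * A), div_pos (ENNReal.toReal_pos hSpos.ne' (measure_ne_top _ _))
    (by positivity), ?_⟩
  refine mul_wassersteinDist_rpow_le_sub hd hc (exists_lower_bound_of_deriv_two hV hc hρ h2) hν
    two_pos fun θ hθ hq => ?_
  set X := ∫⁻ x, ENNReal.ofReal (|θ x - x| ^ (2 : ℝ)) ∂ν
  set φ : ℝ × ℝ → ℝ := fun z => (θ z.1 - θ z.2) / (z.1 - z.2) - 1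
    - Real.log ((θ z.1 - θ z.2) / (z.1 - z.2)) with hφ
  set Φ := ∫⁻ z, ENNReal.ofReal (bregman V z.1 (θ z.1) + φ z) ∂(ν.prod ν) with hΦ
  have hbm : Measurable fun x => bregman V x (θ x) :=
    ((hd.continuous.measurable.comp hθ).sub hd.continuous.measurable).sub
      (hV.hasDerivAt_deriv_two.1.continuous.measurable.mul (hθ.sub measurable_id))
  have hφ0 : ∀ᵐ z ∂ν.prod ν, 0 ≤ φ z := by
    filter_upwards [hq] with z hz
    simp only [hφ]
    linarith [Real.log_le_sub_one_of_pos hz]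
  have hsnd : ∫⁻ z : ℝ × ℝ, ENNReal.ofReal (bregman V z.2 (θ z.2)) ∂(ν.prod ν) ≤ Φ := by
    have e1 := (measurePreserving_snd (μ := ν) (ν := ν)).lintegral_comp hbm.ennreal_ofReal
    have e2 := (measurePreserving_fst (μ := ν) (ν := ν)).lintegral_comp hbm.ennreal_ofReal
    rw [e1, ← e2]
    refine lintegral_mono_ae ?_
    filter_upwards [hφ0] with z hz
    exact ENNReal.ofReal_le_ofReal (by linarith)
  have hXm : Measurable fun x => ENNReal.ofReal (|θ x - x| ^ (2 : ℝ)) :=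
    (((hθ.sub measurable_id).abs).pow_const 2).ennreal_ofReal
  -- The pointwise estimate is integrated over pairs whose second point lies in S. The divergences
  -- at the two coordinates are each bounded by Φ after integration, the first together with φ,
  -- which gives the factor 2.
  have hmain : ν S * X ≤ ENNReal.ofReal (2 * A) * Φ := by
    have hSm : MeasurableSet S := Metric.isOpen_ball.measurableSet
    have e : ν S * X = ∫⁻ z : ℝ × ℝ, ENNReal.ofReal (|θ z.1 - z.1| ^ (2 : ℝ)) *
        S.indicator (fun _ => 1) z.2 ∂(ν.prod ν) := by
      rw [lintegral_prod_mul hXm.aemeasurable (measurable_const.indicator hSm).aemeasurable,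
        lintegral_indicator hSm]
      simp [X, mul_comm]
    have hsum : ENNReal.ofReal (2 * A) * Φ ≥ ENNReal.ofReal A *
        ∫⁻ z : ℝ × ℝ, (ENNReal.ofReal (bregman V z.1 (θ z.1) + φ z)
          + ENNReal.ofReal (bregman V z.2 (θ z.2))) ∂(ν.prod ν) := by
      have hm2 : Measurable fun z : ℝ × ℝ => ENNReal.ofReal (bregman V z.2 (θ z.2)) :=
        (hbm.comp measurable_snd).ennreal_ofReal
      rw [lintegral_add_right _ hm2, two_mul, ENNReal.ofReal_add hA0.le hA0.le, add_mul, mul_add]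
      gcongr
    rw [e]
    refine le_trans ?_ hsum
    rw [← lintegral_const_mul' _ _ ENNReal.ofReal_ne_top]
    refine lintegral_mono_ae ?_
    filter_upwards [hq, hφ0, ae_fst_ne_snd hf.2.1] with z hz hz0 hne
    by_cases hzS : z.2 ∈ S
    · have hD1 := bregman_nonneg hd hc z.1 (θ z.1)
      have hD2 := bregman_nonneg hd hc z.2 (θ z.2)
      rw [Set.indicator_of_mem hzS, mul_one, ← ENNReal.ofReal_add (by linarith) hD2,
        ← ENNReal.ofReal_mul hA0.le]
      refine ENNReal.ofReal_le_ofReal ?_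
      rw [Real.rpow_two, sq_abs]
      refine sq_le_of_far_of_near (x := z.1) (y := z.2) (h₂ := θ z.2 - z.2) (M := M) hρ hc0 hM0 hMR
        hD1 hD2 hne ?_ ?_ (hSR _ hzS) (fun hfar => ?_) ?_
      · simpa using hz
      · simp [hφ]
      · refine mul_sq_le_bregman_of_far hV hc hρ h2' (hfar.imp id fun h => ?_)
        rw [hR] at h
        linarith [abs_nonneg x₀]
      · exact mul_min_sq_le_bregman hV hc hε0 hδ0 (by rw [hM]; linarith) (hnear _ hzS)
    · simp [Set.indicator_of_notMem hzS]
  have h2A : 0 < 2 * A := by positivity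
  rw [ENNReal.ofReal_div_of_pos h2A, ENNReal.ofReal_toReal (measure_ne_top _ _),
    ENNReal.mul_div_right_comm.symm]
  exact ENNReal.div_le_of_le_mul' hmain

end UniformlyConvexAtInfinity

theorem theorem2 (V : ℝ → ℝ) (hV : ContDiff ℝ 2 V)
    (μV : Measure ℝ) (hμV : IsEquilibriumMeasure V μV) :
    -- (1) the inequality,
    (∀ ρ : ℝ, 0 < ρ → ConvexOn ℝ Set.univ (fun x : ℝ => V x - ρ * x ^ 2) →
      ∀ μ : Measure ℝ, IsProbabilityMeasure μ →
        ((ENNReal.ofReal ρ * wassersteinDist 2 μ μV ^ 2 : ℝ≥0∞) : EReal)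
          ≤ logEnergy V μ - logEnergy V μV) ∧
    -- equality for translates in the quadratic case, and sharpness of the constant
    (∀ ρ : ℝ, 0 < ρ → (∀ x : ℝ, V x = ρ * x ^ 2) →
      (∀ m : ℝ,
        ((ENNReal.ofReal ρ * wassersteinDist 2 (μV.map (fun x : ℝ => x + m)) μV ^ 2 : ℝ≥0∞) : EReal)
          = logEnergy V (μV.map (fun x : ℝ => x + m)) - logEnergy V μV) ∧
      (∀ c : ℝ,
        (∀ μ : Measure ℝ, IsProbabilityMeasure μ →
          ((ENNReal.ofReal c * wassersteinDist 2 μ μV ^ 2 : ℝ≥0∞) : EReal)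
            ≤ logEnergy V μ - logEnergy V μV) → c ≤ ρ)) ∧
    -- (2)
    (∀ r ρ : ℝ, 0 < ρ → ConvexOn ℝ Set.univ V → (∀ x : ℝ, r ≤ |x| → ρ ≤ deriv (deriv V) x) →
      ∃ C : ℝ, 0 < C ∧ ∀ μ : Measure ℝ, IsProbabilityMeasure μ →
        ((ENNReal.ofReal C * wassersteinDist 2 μ μV ^ 2 : ℝ≥0∞) : EReal)
          ≤ logEnergy V μ - logEnergy V μV) ∧
    -- (3)
    (∀ p ρ : ℝ, 1 < p → 0 < ρ → ConvexOn ℝ Set.univ (fun x : ℝ => V x - ρ * |x| ^ p) →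
      0 < transportConst p ∧
      ∀ μ : Measure ℝ, IsProbabilityMeasure μ →
        ((ENNReal.ofReal (transportConst p * ρ) * wassersteinDist p μ μV ^ p : ℝ≥0∞) : EReal)
          ≤ logEnergy V μ - logEnergy V μV) := by
  have hd : Differentiable ℝ V := hV.differentiable two_ne_zero
  have := hμV.1
  have part3 : ∀ p ρ : ℝ, 1 < p → 0 < ρ → ConvexOn ℝ Set.univ (fun x : ℝ => V x - ρ * |x| ^ p) →
      0 < transportConst p ∧
      ∀ μ : Measure ℝ, IsProbabilityMeasure μ →
        ((ENNReal.ofReal (transportConst p * ρ) * wassersteinDist p μ μV ^ p : ℝ≥0∞) : EReal)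
          ≤ logEnergy V μ - logEnergy V μV := by
    intro p ρ hp hρ hc
    have hp2 := two_le_of_convexOn_sub_abs_rpow hV hp hρ hc
    have hT := transportConst_pos hp2
    exact ⟨hT, mul_wassersteinDist_rpow_le_sub_of_bregman hd (convexOn_of_sub_abs_rpow hp.le hρ.le hc)
      (exists_lower_bound_of_sub_abs_rpow hd hp2 hρ hc) hμV (by linarith) (mul_pos hT hρ).le
      (mul_transportConst_le_bregman hd hp2 hρ.le hc)⟩
  have part1 : ∀ ρ : ℝ, 0 < ρ → ConvexOn ℝ Set.univ (fun x : ℝ => V x - ρ * x ^ 2) →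
      ∀ μ : Measure ℝ, IsProbabilityMeasure μ →
        ((ENNReal.ofReal ρ * wassersteinDist 2 μ μV ^ 2 : ℝ≥0∞) : EReal)
          ≤ logEnergy V μ - logEnergy V μV := by
    intro ρ hρ hc μ hμ
    have hc' : ConvexOn ℝ Set.univ (fun x : ℝ => V x - ρ * |x| ^ (2 : ℝ)) := by
      simpa only [Real.rpow_two, sq_abs] using hc
    rw [← ENNReal.rpow_two]
    refine mul_wassersteinDist_rpow_le_sub_of_bregman hd
      (convexOn_of_sub_abs_rpow one_le_two hρ.le hc')
      (exists_lower_bound_of_sub_abs_rpow hd le_rfl hρ hc') hμV two_pos hρ.le (fun x y => ?_) μ hμ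
    rw [Real.rpow_two, sq_abs]
    exact mul_sq_le_bregman hd hc x y
  refine ⟨part1, fun ρ hρ hVρ => ?_, fun r ρ hρ hc h2 => ?_, part3⟩
  · obtain ⟨hi, hval⟩ := quadratic_translate hμV hρ hVρ
    have hc : ConvexOn ℝ Set.univ (fun x : ℝ => V x - ρ * x ^ 2) := by
      simp only [hVρ, sub_self]
      exact convexOn_const 0 convex_univ
    have hlow := fun m => ofReal_sq_le_wassersteinDist_two_sq hi m
    have hcoe : ∀ s : ℝ, 0 ≤ s → ((s : ℝ) : EReal) = ((ENNReal.ofReal s : ℝ≥0∞) : EReal) := by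
      intro s hs
      rw [EReal.coe_ennreal_ofReal, max_eq_left hs]
    have hprob : ∀ m : ℝ, IsProbabilityMeasure (μV.map fun x => x + m) := fun m =>
      Measure.isProbabilityMeasure_map (measurable_id.add_const m).aemeasurable
    constructor
    · intro m
      refine le_antisymm (part1 ρ hρ hc _ (hprob m)) ?_
      rw [hval, hcoe _ (by positivity), EReal.coe_ennreal_le_coe_ennreal_iff,
        ENNReal.ofReal_mul hρ.le]
      gcongr
      exact hlow m
    · intro c h
      -- A single translate suffices. No sign is assumed on c: since ρ ≥ 0, comparing the
      -- truncations still gives c ≤ ρ.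
      have h1 := h _ (hprob 1)
      rw [hval, hcoe _ (by positivity), EReal.coe_ennreal_le_coe_ennreal_iff] at h1
      have h3 : ENNReal.ofReal c ≤ ENNReal.ofReal ρ := by
        calc ENNReal.ofReal c = ENNReal.ofReal c * ENNReal.ofReal (1 ^ 2) := by simp
          _ ≤ _ := mul_le_mul_right (hlow 1) _
          _ ≤ _ := h1
          _ = ENNReal.ofReal ρ := by simp
      exact (ENNReal.ofReal_le_ofReal_iff hρ.le).1 h3
  · simpa only [ENNReal.rpow_two] using exists_pos_mul_wassersteinDist_two_le_sub hV hc hμV hρ h2
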